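/- **Setting.** Let $V$ be a separable real Banach space, $T\in\mathbb N$, $I=\{0,1,\dots,T\}$, $r\ge 0$. Write $(I\to Y)$ for the set of paths $Y^I$ with the product topology and its Borel $\sigma$-algebra. *Adapted processes.* $\mathcal S(V)$ is the class of adapted processes $\mathbf X=(\Omega,\mathbb P,(\mathcal F_t)_{t\in I},X)$: a filtered probability space with a map $X:\Omega\to(I\to V)$ such that $X_t$ is $\mathcal F_t$-measurable for all $t\in I$ (different processes may live on different filtered probability spaces). Put $\operatorname{Prob}_0(V)=V$ and let $\operatorname{Prob}_{k+1}(V)$ be the space of Borel probability measures on $(I\to\operatorname{Prob}_k(V))$ with the weak topology. The prediction processes of $\mathbf X$ are $\hat X^0=X$ and $\hat X^{k+1}_t=\mathbb P(\hat X^k\in\cdot\mid\mathcal F_t)$ (regular conditional laws), $t\in I$, so that $\operatorname{Law}(\hat X^k)\in\operatorname{Prob}_{k+1}(V)$. The extended weak topology $\hat\tau_r$ on $\mathcal S(V)$ is the initial topology of $\mathbf X\mapsto\operatorname{Law}(\hat X^r)$; thus $\mathbf X^n\to\mathbf X$ in $\hat\tau_r$ iff $\mathbb E f(\hat X^{n,r})\to\mathbb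 E f(\hat X^r)$ for all bounded continuous $f:(I\to\operatorname{Prob}_r(V))\to\mathbb R$. *Tensor algebras.* For a Banach space $W$ let $E=\mathbb R\oplus W$ with norm $|s|+\|w\|$. An admissible family of norms on $(E^{\otimes m})_{m\ge0}$ consists of norms on the algebraic tensor powers such that: they are $|\cdot|$ on $E^{\otimes 0}=\mathbb R$ and the given norm on $E^{\otimes 1}=E$; $\|v_1\otimes\dots\otimes v_m\|=\|v_{\sigma(1)}\otimes\dots\otimes v_{\sigma(m)}\|$ for all permutations $\sigma$; $\|a\otimes b\|\le\|a\|\,\|b\|$ for $a\in E^{\otimes m}$, $b\in E^{\otimes n}$; and every functional $\ell_1\otimes\dots\otimes\ell_m$ with $\ell_i$ in the dual of $E$ is continuous on $E^{\otimes m}$ (e.g. projective or injective norms). Given such a family, $\mathbf T^1(W)$ is the completion of $\bigoplus_m E^{\otimes m}$ under $\|t\|=\sum_m\|t_m\|$. The signature of $x\in(I\to W)$ is $$\mathrm S(x)=\exp(\Delta_0x)\cdot\exp(\Delta_1x)\cdots\exp(\Delta_Tx)\in\mathbf T^1(W),$$ where $\Delta_0x=(1,x(0))$, $\Delta_tx=(1,x(t)-x(t-1))$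 for $t\ge1$, $\exp(v)=(v^{\otimes m}/m!)_{m\ge0}$ and $(s\cdot t)_m=\sum_{i+j=m}s_i\otimes t_j$. A tensor normalization is a continuous, injective map $\Lambda:\{t\in\mathbf T^1(W):t_0=1\}\to\mathbf T^1(W)$ with bounded range of the form $\Lambda(t)=(\lambda(t)^mt_m)_{m\ge0}$ for some function $\lambda>0$. *The distance.* Put $\mathbf T^0(V)=V$ and $\mathbf T^{k+1}(V)=\mathbf T^1(\mathbf T^k(V))$, where for every $k$ an arbitrary admissible family of norms on the tensor powers of $\mathbb R\oplus\mathbf T^k(V)$ and an arbitrary tensor normalization $\Lambda_k$ on $\{t\in\mathbf T^{k+1}(V):t_0=1\}$ have been fixed. The robust expected signatures $\bar{\mathrm S}_k:\operatorname{Prob}_k(V)\to\mathbf T^k(V)$ are $\bar{\mathrm S}_0=\mathrm{id}_V$ and $$\bar{\mathrm S}_{k+1}(\mu)=\int\Lambda_k\big(\mathrm S\big(t\mapsto\bar{\mathrm S}_k(x(t))\big)\big)\,\mu(dx).$$ Finally $\Phi_r(\mathbf X)=\bar{\mathrm S}_{r+1}(\operatorname{Law}(\hat X^r))$ and $d_r(\mathbf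 X,\mathbf Y)=\|\Phi_r(\mathbf X)-\Phi_r(\mathbf Y)\|_{\mathbf T^{r+1}(V)}$. **Proposition.** Let $(\mathbf X^n)_{n\ge0}\subset\mathcal S(V)$ and $\mathbf X\in\mathcal S(V)$. 1. If $\mathbf X^n\to\mathbf X$ in $(\mathcal S(V),\hat\tau_r)$, then $d_r(\mathbf X^n,\mathbf X)\to0$ as $n\to\infty$. 2. If $(\mathbf X^n)_{n\ge0}$ is contained in a compact set of $(\mathcal S(V),\hat\tau_r)$, then $d_r(\mathbf X^n,\mathbf X)\to0$ as $n\to\infty$ implies that $\mathbf X^n\to\mathbf X$ in $(\mathcal S(V),\hat\tau_r)$. -/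

import Mathlib

open MeasureTheory ProbabilityTheory Filter Topology
open scoped TensorProduct Nat

universe u w

noncomputable section

/-! ## Paths and rank `r` probability measures -/

/-- Paths `(I → Y)` indexed by `I = {0, 1, …, T}`, with the product topology and its Borel
σ-algebra. -/
def DPath (T : ℕ) (Y : Type u) : Type u := Fin (T + 1) → Y

instance DPath.instTopologicalSpace (T : ℕ) (Y : Type u) [TopologicalSpace Y] :
    TopologicalSpace (DPath T Y) :=
  inferInstanceAs (TopologicalSpace (Fin (T + 1) → Y))

instance DPath.instMeasurableSpace (T : ℕ) (Y : Type u) [TopologicalSpace Y] :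
    MeasurableSpace (DPath T Y) :=
  borel (DPath T Y)

instance DPath.instBorelSpace (T : ℕ) (Y : Type u) [TopologicalSpace Y] :
    BorelSpace (DPath T Y) :=
  ⟨rfl⟩

/-- The spaces `Prob_r(V)` as topological spaces: `Prob_0(V) = V`, and
`Prob_{r+1}(V) = Prob(I → Prob_r(V))` is the set of Borel probability measures on paths in
`Prob_r(V)`, with the weak topology. -/
def rankProb (T : ℕ) (V : Type u) [TopologicalSpace V] : ℕ → TopCat.{u}
  | 0 => TopCat.of V
  | r + 1 => TopCat.of (ProbabilityMeasure (DPath T (rankProb T V r)))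

instance rankProb.instNonempty (T : ℕ) (V : Type u) [TopologicalSpace V] [Nonempty V] :
    (r : ℕ) → Nonempty (rankProb T V r)
  | 0 => inferInstanceAs (Nonempty V)
  | r + 1 =>
    let x : DPath T (rankProb T V r) := fun _ => (rankProb.instNonempty T V r).some
    ⟨(⟨Measure.dirac x, inferInstance⟩ : ProbabilityMeasure (DPath T (rankProb T V r)))⟩

/-! ## Adapted processes, prediction processes, extended weak topologies -/

/-- Adapted stochastic processes `(Ω, ℙ, (𝓕_t)_{t ∈ I}, X)` in discrete time `I = {0, …, T}` with
state space `V` (carrying its Borel σ-algebra). -/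
structure AdaptedProcess (T : ℕ) (V : Type u) [TopologicalSpace V] where
  /-- the sample space -/
  Ω : Type w
  /-- the ambient σ-algebra -/
  mΩ : MeasurableSpace Ω
  /-- the probability measure -/
  prob : Measure Ω
  isProb : IsProbabilityMeasure prob
  /-- the filtration -/
  filtration : Filtration (Fin (T + 1)) mΩ
  /-- the process, as a random path -/
  X : Ω → DPath T V
  adapted : ∀ t, Measurable[filtration t, borel V] (fun ω => X ω t)

attribute [instance] AdaptedProcess.mΩ AdaptedProcess.isProb

/-- `κ` is a regular version of the conditional law `P(Z ∈ · | m)`: it is measurable from `m` to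
the Borel σ-algebra of the weak topology, and `κ(B) = P(Z ∈ B | m)` almost surely for every Borel
set `B`. -/
def IsCondLaw {Ω : Type w} {mΩ : MeasurableSpace Ω} (P : Measure Ω) (m : MeasurableSpace Ω)
    {S : Type u} [TopologicalSpace S] [MeasurableSpace S] [BorelSpace S]
    (Z : Ω → S) (κ : Ω → ProbabilityMeasure S) : Prop :=
  Measurable[m, borel (ProbabilityMeasure S)] κ ∧
    ∀ B : Set S, MeasurableSet B →
      (fun ω => (κ ω : Measure S).real B) =ᵐ[P] P⟦Z ⁻¹' B | m⟧

namespace AdaptedProcess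

variable {T : ℕ} {V : Type u} [TopologicalSpace V]

/-- `Y` is a version of the path `t ↦ P(Z ∈ · | 𝓕_t)` of conditional laws of `Z`. -/
def IsPrediction (A : AdaptedProcess.{u, w} T V) {S : Type u} [TopologicalSpace S]
    [MeasurableSpace S] [BorelSpace S] (Z : A.Ω → S)
    (Y : A.Ω → DPath T (ProbabilityMeasure S)) : Prop :=
  Measurable Y ∧ ∀ t, IsCondLaw A.prob (A.filtration t) Z (fun ω => Y ω t)

theorem measurable_X [SecondCountableTopology V] (A : AdaptedProcess.{u, w} T V) :
    Measurable A.X := by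
  let _ : MeasurableSpace V := borel V
  have : BorelSpace V := ⟨rfl⟩
  have h : (MeasurableSpace.pi : MeasurableSpace (Fin (T + 1) → V)) =
      borel (Fin (T + 1) → V) := BorelSpace.measurable_eq
  have hX : @Measurable A.Ω (Fin (T + 1) → V) A.mΩ MeasurableSpace.pi A.X :=
    measurable_pi_lambda _ fun t => (A.adapted t).mono (A.filtration.le t) le_rfl
  rw [h] at hX
  exact hX

open Classical in
/-- The rank `r` prediction process, as a random path in `Prob_r(V)`: `X̂⁰ = X` and
`X̂^{r+1}_t = P(X̂^r ∈ · | 𝓕_t)`. For `V` Polish all the spaces `Prob_r(V)` are Polish, so that a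
regular version exists; one is chosen (any two agree almost surely). The last branch only makes the
definition total on spaces where there is no version. -/
def prediction [SecondCountableTopology V] [Nonempty V] (A : AdaptedProcess.{u, w} T V) :
    (r : ℕ) → {Z : A.Ω → DPath T (rankProb T V r) // Measurable Z}
  | 0 => ⟨A.X, A.measurable_X⟩
  | r + 1 =>
    if h : ∃ Y : A.Ω → DPath T (ProbabilityMeasure (DPath T (rankProb T V r))),
        A.IsPrediction (prediction A r).1 Y then
      ⟨h.choose, h.choose_spec.1⟩
    else
      ⟨fun _ _ => Classical.arbitrary (rankProb T V (r + 1)), measurable_const⟩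

/-- The law of `X̂^r`, an element of `Prob(I → Prob_r(V)) = Prob_{r+1}(V)`. -/
def predictionLaw [SecondCountableTopology V] [Nonempty V] (A : AdaptedProcess.{u, w} T V)
    (r : ℕ) : ProbabilityMeasure (DPath T (rankProb T V r)) :=
  ⟨A.prob.map (A.prediction r).1,
    Measure.isProbabilityMeasure_map (A.prediction r).2.aemeasurable⟩

end AdaptedProcess

/-- The extended weak topology of rank `r` on adapted processes: the topology of weak convergence
of the laws of the rank `r` prediction processes. -/
abbrev extendedWeakTopology (T : ℕ) (V : Type u) [TopologicalSpace V] [SecondCountableTopology V]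
    [Nonempty V] (r : ℕ) : TopologicalSpace (AdaptedProcess.{u, w} T V) :=
  TopologicalSpace.induced (fun A => A.predictionLaw r) inferInstance

/-! ## Tensor algebras -/

/-- An admissible family of norms on the tensor powers `E^{⊗m}` of a normed space `E`. -/
structure AdmissibleNorms (E : Type u) [NormedAddCommGroup E] [NormedSpace ℝ E] where
  /-- the norm on `E^{⊗m}` -/
  nrm : (m : ℕ) → Seminorm ℝ (⨂[ℝ]^m E)
  eq_zero : ∀ m (a : ⨂[ℝ]^m E), nrm m a = 0 → a = 0
  /-- on `E^{⊗0} = ℝ` it is the absolute value -/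
  nrm_zero : ∀ c : ℝ, nrm 0 (TensorPower.algebraMap₀ c) = |c|
  /-- on `E^{⊗1} = E` it is the given norm -/
  nrm_one : ∀ v : E, nrm 1 (PiTensorProduct.tprod ℝ fun _ => v) = ‖v‖
  nrm_perm : ∀ m (s : Equiv.Perm (Fin m)) (v : Fin m → E),
    nrm m (PiTensorProduct.tprod ℝ fun i => v (s i)) = nrm m (PiTensorProduct.tprod ℝ v)
  nrm_mul_le : ∀ m n (a : ⨂[ℝ]^m E) (b : ⨂[ℝ]^n E),
    nrm (m + n) (TensorPower.mulEquiv (a ⊗ₜ[ℝ] b)) ≤ nrm m a * nrm n b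
  /-- the elementary functionals `ℓ₁ ⊗ ⋯ ⊗ ℓ_m`, with `ℓ_i` in the dual of `E`, are continuous -/
  continuous_elementary : ∀ m (l : Fin m → (E →L[ℝ] ℝ)), ∃ C : ℝ, ∀ a : ⨂[ℝ]^m E,
    |PiTensorProduct.lift ((MultilinearMap.mkPiAlgebra ℝ (Fin m) ℝ).compLinearMap
      fun i => (l i : E →ₗ[ℝ] ℝ)) a| ≤ C * nrm m a

section TensorAlgebra

variable {E : Type u} [NormedAddCommGroup E] [NormedSpace ℝ E]

/-- The `m`-th tensor power of `E`, normed by an admissible family of norms. -/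
def TensorPow (_N : AdmissibleNorms E) (m : ℕ) : Type u := ⨂[ℝ]^m E

instance TensorPow.instAddCommGroup (N : AdmissibleNorms E) (m : ℕ) :
    AddCommGroup (TensorPow N m) :=
  inferInstanceAs (AddCommGroup (⨂[ℝ]^m E))

instance TensorPow.instModule (N : AdmissibleNorms E) (m : ℕ) : Module ℝ (TensorPow N m) :=
  inferInstanceAs (Module ℝ (⨂[ℝ]^m E))

instance TensorPow.instNormedAddCommGroup (N : AdmissibleNorms E) (m : ℕ) :
    NormedAddCommGroup (TensorPow N m) :=
  AddGroupNorm.toNormedAddCommGroup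
    { toFun := fun a => N.nrm m a
      map_zero' := map_zero (N.nrm m)
      add_le' := map_add_le_add (N.nrm m)
      neg' := map_neg_eq_map (N.nrm m)
      eq_zero_of_map_eq_zero' := N.eq_zero m }

instance TensorPow.instNormedSpace (N : AdmissibleNorms E) (m : ℕ) :
    NormedSpace ℝ (TensorPow N m) where
  norm_smul_le c a := (map_smul_eq_mul (N.nrm m) c a).le

/-- The inclusion of `E^{⊗m}` into its completion. -/
def TensorPow.incl (N : AdmissibleNorms E) (m : ℕ) (a : ⨂[ℝ]^m E) :
    UniformSpace.Completion (TensorPow N m) :=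
  UniformSpace.Completion.coe' (α := TensorPow N m) a

theorem TensorPow.norm_incl (N : AdmissibleNorms E) (m : ℕ) (a : ⨂[ℝ]^m E) :
    ‖TensorPow.incl N m a‖ = N.nrm m a :=
  UniformSpace.Completion.norm_coe (E := TensorPow N m) a

/-- The completion of `⨁_m E^{⊗m}` in the norm `∑_m ‖t_m‖`, realised as the `ℓ¹`-sum of the
completions of the tensor powers `E^{⊗m}`. -/
abbrev TensorSeries (N : AdmissibleNorms E) : Type u :=
  lp (fun m => UniformSpace.Completion (TensorPow N m)) 1

/-- The tensor exponential `(v^{⊗m} / m!)_m`. -/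
def tensorExp (v : E) : (m : ℕ) → ⨂[ℝ]^m E :=
  fun m => ((m ! : ℝ)⁻¹) • PiTensorProduct.tprod ℝ (fun _ : Fin m => v)

/-- The unit `(1, 0, 0, …)` of the tensor convolution product. -/
def tensorOne : (m : ℕ) → ⨂[ℝ]^m E
  | 0 => TensorPower.algebraMap₀ 1
  | _ + 1 => 0

/-- The tensor convolution product `(s · t)_m = ∑_{i + j = m} s_i ⊗ t_j`. -/
def tensorConv (s t : (m : ℕ) → ⨂[ℝ]^m E) : (m : ℕ) → ⨂[ℝ]^m E :=
  fun m => ∑ p : {p : ℕ × ℕ // p ∈ Finset.HasAntidiagonal.antidiagonal m},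
    TensorPower.cast ℝ E (Finset.HasAntidiagonal.mem_antidiagonal.mp p.2)
      (TensorPower.mulEquiv (s p.1.1 ⊗ₜ[ℝ] t p.1.2))

end TensorAlgebra

/-! ## The signature -/

section Signature

variable {T : ℕ} {W : Type u} [NormedAddCommGroup W] [NormedSpace ℝ W]

/-- The space `ℝ ⊕ W`, with the norm `|s| + ‖w‖`. -/
abbrev TimeExt (W : Type u) [NormedAddCommGroup W] [NormedSpace ℝ W] : Type u :=
  WithLp 1 (ℝ × W)

/-- The time-augmented increments `Δ_0 x = (1, x(0))`, `Δ_t x = (1, x(t) - x(t-1))` for `t ≥ 1`. -/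
def increment (x : DPath T W) (t : Fin (T + 1)) : TimeExt W :=
  WithLp.toLp 1 ((1 : ℝ),
    Fin.cases (motive := fun _ => W) (x 0) (fun s : Fin T => x s.succ - x s.castSucc) t)

/-- The components of the signature `S(x) = exp(Δ_0 x) · exp(Δ_1 x) ⋯ exp(Δ_T x)`. -/
def sigComponents (x : DPath T W) : (m : ℕ) → ⨂[ℝ]^m (TimeExt W) :=
  (List.ofFn fun t : Fin (T + 1) => tensorExp (increment x t)).foldr tensorConv tensorOne

end Signature

section Summability

variable {E : Type u} [NormedAddCommGroup E] [NormedSpace ℝ E] (N : AdmissibleNorms E)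

theorem nrm_cast {m n : ℕ} (h : m = n) (a : ⨂[ℝ]^m E) :
    N.nrm n (TensorPower.cast ℝ E h a) = N.nrm m a := by
  subst h
  rw [TensorPower.cast_refl]
  rfl

theorem nrm_pow_le (v : E) (m : ℕ) :
    N.nrm m (PiTensorProduct.tprod ℝ fun _ : Fin m => v) ≤ ‖v‖ ^ m := by
  induction m with
  | zero =>
    have h : (PiTensorProduct.tprod ℝ fun _ : Fin 0 => v) =
        (TensorPower.algebraMap₀ 1 : ⨂[ℝ]^0 E) := by
      rw [TensorPower.algebraMap₀_one, TensorPower.gOne_def]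
      congr 1
      exact Subsingleton.elim _ _
    rw [h, N.nrm_zero]
    simp
  | succ m ih =>
    have h : (PiTensorProduct.tprod ℝ fun _ : Fin (m + 1) => v) =
        TensorPower.mulEquiv ((PiTensorProduct.tprod ℝ fun _ : Fin m => v) ⊗ₜ[ℝ]
          (PiTensorProduct.tprod ℝ fun _ : Fin 1 => v)) := by
      rw [← TensorPower.gMul_def, TensorPower.tprod_mul_tprod]
      congr 1
      ext i
      refine Fin.addCases (fun j => ?_) (fun j => ?_) i <;> simp
    rw [h, pow_succ]
    refine (N.nrm_mul_le _ _ _ _).trans ?_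
    rw [N.nrm_one]
    exact mul_le_mul_of_nonneg_right ih (norm_nonneg _)

theorem summable_tensorExp (v : E) : Summable fun m => N.nrm m (tensorExp v m) := by
  refine Summable.of_nonneg_of_le (fun m => apply_nonneg _ _) (fun m => ?_)
    (Real.summable_pow_div_factorial ‖v‖)
  rw [tensorExp, map_smul_eq_mul, Real.norm_of_nonneg (by positivity), div_eq_inv_mul]
  exact mul_le_mul_of_nonneg_left (nrm_pow_le N v m) (by positivity)

theorem summable_tensorOne : Summable fun m => N.nrm m (tensorOne m) := by
  refine summable_of_ne_finset_zero (s := {0}) fun m hm => ?_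
  cases m with
  | zero => simp at hm
  | succ m => exact map_zero _

theorem nrm_tensorConv_le (s t : (m : ℕ) → ⨂[ℝ]^m E) (m : ℕ) :
    N.nrm m (tensorConv s t m) ≤
      ∑ p ∈ Finset.HasAntidiagonal.antidiagonal m, N.nrm p.1 (s p.1) * N.nrm p.2 (t p.2) := by
  rw [← Finset.sum_coe_sort (Finset.HasAntidiagonal.antidiagonal m)
    (fun p => N.nrm p.1 (s p.1) * N.nrm p.2 (t p.2)), tensorConv]
  refine (Finset.le_sum_of_subadditive (N.nrm m) (map_zero _).le (map_add_le_add _) _ _).trans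
    (Finset.sum_le_sum fun p _ => ?_)
  rw [nrm_cast]
  exact N.nrm_mul_le _ _ _ _

theorem summable_antidiagonal_mul {f g : ℕ → ℝ} (hf : Summable f) (hg : Summable g)
    (hf0 : 0 ≤ f) (hg0 : 0 ≤ g) :
    Summable fun m => ∑ p ∈ Finset.HasAntidiagonal.antidiagonal m, f p.1 * g p.2 :=
  summable_sum_mul_antidiagonal_of_summable_mul (hf.mul_of_nonneg hg hf0 hg0)

theorem summable_tensorConv {s t : (m : ℕ) → ⨂[ℝ]^m E} (hs : Summable fun m => N.nrm m (s m))
    (ht : Summable fun m => N.nrm m (t m)) : Summable fun m => N.nrm m (tensorConv s t m) := by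
  have h := summable_antidiagonal_mul hs ht (fun m => apply_nonneg (N.nrm m) (s m))
    (fun m => apply_nonneg (N.nrm m) (t m))
  refine Summable.of_nonneg_of_le (fun m => ?_) (fun m => ?_) h
  · exact apply_nonneg (N.nrm m) (tensorConv s t m)
  · exact nrm_tensorConv_le N s t m

theorem tensorConv_zero (s t : (m : ℕ) → ⨂[ℝ]^m E) (hs : s 0 = TensorPower.algebraMap₀ 1)
    (ht : t 0 = TensorPower.algebraMap₀ 1) : tensorConv s t 0 = TensorPower.algebraMap₀ 1 := by
  have key : ∀ p : {p : ℕ × ℕ // p ∈ Finset.HasAntidiagonal.antidiagonal 0},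
      TensorPower.cast ℝ E (Finset.HasAntidiagonal.mem_antidiagonal.mp p.2)
        (TensorPower.mulEquiv (s p.1.1 ⊗ₜ[ℝ] t p.1.2)) =
      (TensorPower.algebraMap₀ 1 : ⨂[ℝ]^0 E) := by
    rintro ⟨⟨i, j⟩, hp⟩
    obtain ⟨rfl, rfl⟩ : i = 0 ∧ j = 0 := by simpa using hp
    change TensorPower.cast ℝ E _ (TensorPower.mulEquiv (s 0 ⊗ₜ[ℝ] t 0)) = _
    rw [hs, ht, ← TensorPower.gMul_def, TensorPower.algebraMap₀_mul_algebraMap₀, _root_.mul_one]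
  rw [tensorConv, Finset.sum_congr rfl fun p _ => key p, Finset.sum_const, Finset.card_univ,
    Fintype.card_coe]
  simp

theorem tensorExp_zero (v : E) : tensorExp v 0 = TensorPower.algebraMap₀ 1 := by
  rw [tensorExp, TensorPower.algebraMap₀_one, TensorPower.gOne_def]
  simp only [Nat.factorial_zero, Nat.cast_one, inv_one, one_smul]
  congr 1
  exact Subsingleton.elim _ _

end Summability

section RobustSignature

variable {T : ℕ} {W : Type u} [NormedAddCommGroup W] [NormedSpace ℝ W]

theorem sigComponents_zero (x : DPath T W) :
    sigComponents x 0 = TensorPower.algebraMap₀ 1 := by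
  have key : ∀ l : List ((m : ℕ) → ⨂[ℝ]^m (TimeExt W)),
      (∀ s ∈ l, s 0 = TensorPower.algebraMap₀ 1) →
        l.foldr tensorConv tensorOne 0 = TensorPower.algebraMap₀ 1 := by
    intro l
    induction l with
    | nil => intro _; rfl
    | cons s l ih =>
      intro h
      exact tensorConv_zero _ _ (h s (by simp)) (ih fun s' hs' => h s' (by simp [hs']))
  refine key _ fun s hs => ?_
  obtain ⟨t, rfl⟩ := List.mem_ofFn.mp hs
  exact tensorExp_zero _

theorem summable_sigComponents (N : AdmissibleNorms (TimeExt W)) (x : DPath T W) :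
    Summable fun m => N.nrm m (sigComponents x m) := by
  have key : ∀ l : List ((m : ℕ) → ⨂[ℝ]^m (TimeExt W)),
      (∀ s ∈ l, Summable fun m => N.nrm m (s m)) →
        Summable fun m => N.nrm m (l.foldr tensorConv tensorOne m) := by
    intro l
    induction l with
    | nil => intro _; exact summable_tensorOne N
    | cons s l ih =>
      intro h
      exact summable_tensorConv N (h s (by simp)) (ih fun s' hs' => h s' (by simp [hs']))
  refine key _ fun s hs => ?_
  obtain ⟨t, rfl⟩ := List.mem_ofFn.mp hs
  exact summable_tensorExp N _

/-- The elements `t` of the completed tensor algebra with `t_0 = 1`. -/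
def UnitTensorSeries {E : Type u} [NormedAddCommGroup E] [NormedSpace ℝ E]
    (N : AdmissibleNorms E) : Type u :=
  {t : TensorSeries N // (t : (m : ℕ) → UniformSpace.Completion (TensorPow N m)) 0 =
    TensorPow.incl N 0 (TensorPower.algebraMap₀ 1)}

instance UnitTensorSeries.instTopologicalSpace {E : Type u} [NormedAddCommGroup E]
    [NormedSpace ℝ E] (N : AdmissibleNorms E) : TopologicalSpace (UnitTensorSeries N) :=
  inferInstanceAs (TopologicalSpace
    {t : TensorSeries N // (t : (m : ℕ) → UniformSpace.Completion (TensorPow N m)) 0 =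
      TensorPow.incl N 0 (TensorPower.algebraMap₀ 1)})

/-- The signature map `S : (I → W) → T¹(W)`, where `T¹(W)` is the completed tensor algebra over
`ℝ ⊕ W`. -/
def signature (N : AdmissibleNorms (TimeExt W)) (x : DPath T W) : UnitTensorSeries N :=
  ⟨⟨fun m => TensorPow.incl N m (sigComponents x m), by
    refine memℓp_gen ?_
    simp only [ENNReal.toReal_one, Real.rpow_one, TensorPow.norm_incl]
    exact summable_sigComponents N x⟩,
    congrArg (TensorPow.incl N 0) (sigComponents_zero x)⟩

/-- A tensor normalization: a continuous, injective, bounded map `Λ` of the form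
`t ↦ δ_{λ(t)} t = (λ(t)^m t_m)_m` with `λ(t) > 0`, on the tensor series `t` with `t_0 = 1`. -/
structure TensorNormalization {E : Type u} [NormedAddCommGroup E] [NormedSpace ℝ E]
    (N : AdmissibleNorms E) where
  /-- the dilation factor `λ` -/
  scale : UnitTensorSeries N → ℝ
  scale_pos : ∀ t, 0 < scale t
  /-- the map `Λ` -/
  toFun : UnitTensorSeries N → TensorSeries N
  toFun_apply : ∀ (t : UnitTensorSeries N) (m : ℕ),
    (toFun t : (m : ℕ) → UniformSpace.Completion (TensorPow N m)) m = scale t ^ m • t.1 m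
  continuous_toFun : Continuous toFun
  injective_toFun : Function.Injective toFun
  bounded_toFun : ∃ R : ℝ, ∀ t, ‖toFun t‖ ≤ R

end RobustSignature

/-! ## Higher rank expected signatures -/

/-- A real Banach space, bundled. -/
structure BanachSp : Type (u + 1) where
  /-- the underlying type -/
  carrier : Type u
  normedAddCommGroup : NormedAddCommGroup carrier
  normedSpace : NormedSpace ℝ carrier
  completeSpace : CompleteSpace carrier

instance BanachSp.instCoeSort : CoeSort BanachSp.{u} (Type u) := ⟨BanachSp.carrier⟩

attribute [instance] BanachSp.normedAddCommGroup BanachSp.normedSpace BanachSp.completeSpace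

/-- The choices that enter the robust signature map on paths in `W`: admissible norms on the tensor
powers of `ℝ ⊕ W`, and a tensor normalization. -/
structure SignatureScheme (W : Type u) [NormedAddCommGroup W] [NormedSpace ℝ W] where
  norms : AdmissibleNorms (TimeExt W)
  normalization : TensorNormalization norms

/-- The robust signature map `Λ ∘ S`. -/
def robustSignature {T : ℕ} {W : Type u} [NormedAddCommGroup W] [NormedSpace ℝ W]
    (c : SignatureScheme W) (x : DPath T W) : TensorSeries c.norms :=
  c.normalization.toFun (signature c.norms x)

section HigherRank

variable (c : ℕ → (W : BanachSp.{u}) → SignatureScheme W)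
variable (T : ℕ) (V : Type u) [NormedAddCommGroup V] [NormedSpace ℝ V] [CompleteSpace V]

/-- The Banach spaces `T^0(V) = V`, `T^{r+1}(V) = T¹(T^r(V))`, the norms on the tensor powers of
`ℝ ⊕ T^r(V)` being those of the scheme `c r`. Only the values of `c` on the spaces of this tower
matter. -/
def rankTensor : ℕ → BanachSp.{u}
  | 0 => ⟨V, inferInstance, inferInstance, inferInstance⟩
  | r + 1 => ⟨TensorSeries (c r (rankTensor r)).norms, inferInstance, inferInstance, inferInstance⟩

/-- The robust expected signature map of rank `r` on `Prob_r(V)`: the identity of `V` for `r = 0`,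
and `μ ↦ ∫ ΛS(t ↦ S̄_r(x(t))) μ(dx)`, a Bochner integral in `T^{r+1}(V)`, at rank `r + 1`. -/
def expectedSignature : (r : ℕ) → rankProb T V r → rankTensor c V r
  | 0 => fun v => v
  | r + 1 => fun (μ : ProbabilityMeasure (DPath T (rankProb T V r))) =>
    (∫ x : DPath T (rankProb T V r), robustSignature (c r (rankTensor c V r))
        (fun t : Fin (T + 1) => expectedSignature r (x t) : DPath T (rankTensor c V r))
      ∂(μ : Measure (DPath T (rankProb T V r))) :
      TensorSeries (c r (rankTensor c V r)).norms)

variable {T V}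
variable [SecondCountableTopology V]

/-- `Φ_r(X) = S̄_{r+1}(Law(X̂^r))`. -/
def adaptedFeature (r : ℕ) (A : AdaptedProcess.{u, w} T V) : rankTensor c V (r + 1) :=
  expectedSignature c T V (r + 1) (A.predictionLaw r)

/-- The rank `r` adapted signature distance `d_r(X, Y) = ‖Φ_r(X) - Φ_r(Y)‖`. -/
def adaptedSigDist (r : ℕ) (A B : AdaptedProcess.{u, w} T V) : ℝ :=
  ‖adaptedFeature c r A - adaptedFeature c r B‖

end HigherRank

end

/-! Everything reduces to two properties of the expected signature `expectedSignature c T V (r +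
1)`: it is weak-to-norm continuous and injective. Continuity gives the first claim. For the second,
every weak cluster point of the laws has the same expected signature as the limit law, hence equals
it, and a sequence in a compact set with a single possible cluster point converges.

Continuity at each rank: the robust signature is bounded and continuous, and the Bochner integral of
such a map is norm continuous in the measure (`continuous_integral_probabilityMeasure`). Bounded
continuous partition functions reduce this to scalar integrals, without tightness.

Injectivity is obtained by strengthening it to a measurable statement that passes through the ranks:
the real functions `l ∘ S̄_k`, with `l` a continuous functional, generate the Borel σ-algebra of
`Prob_k(V)` (`expectedSignature_continuous_and_borel_le`). At rank `0` this is the cylindrical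
σ-algebra of a separable normed space. For the step, coordinates of the robust signature satisfy the
shuffle identity, so their span is an algebra (`robustAlgebra`). The time coordinate reveals the
dilation factor, and then words `τ ⋯ τ l` reveal every increment
(`measurable_functional_of_robustSignature`); hence this algebra generates the Borel sets of path
space. Integrals over such an algebra determine the measure of every Borel set measurably
(`measurable_toMeasure_of_subalgebra`), and evaluations on Borel sets generate the weak Borel
σ-algebra (`borel_probabilityMeasure_le`). Since singletons are Borel, generation implies
injectivity. -/

noncomputable section

/-! ### The weak topology and its Borel σ-algebra. -/

section WeakTopology

open scoped NNReal ENNReal BoundedContinuousFunction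

variable {X : Type*} [TopologicalSpace X] [HasOuterApproxClosed X]
  [MeasurableSpace X]

/-- Portmanteau, applied to the identity along the neighbourhood filter of `μ` instead of along a
sequence. -/
theorem isOpen_setOf_lt_probabilityMeasure [OpensMeasurableSpace X] {U : Set X} (hU : IsOpen U)
    (q : ℝ≥0) : IsOpen {μ : ProbabilityMeasure X | q < μ U} := by
  refine isOpen_iff_mem_nhds.2 fun μ hμ => ?_
  have h := ProbabilityMeasure.le_liminf_measure_open_of_tendsto (μ := μ)
    (μs := fun ν : ProbabilityMeasure X => ν) tendsto_id hU
  have h' : (q : ℝ≥0∞) < (𝓝 μ).liminf fun ν : ProbabilityMeasure X => (ν : Measure X) U := by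
    refine lt_of_lt_of_le ?_ h
    rw [← ProbabilityMeasure.ennreal_coeFn_eq_coeFn_toMeasure]
    exact_mod_cast hμ
  filter_upwards [eventually_lt_of_lt_liminf h'] with ν hν
  rw [← ProbabilityMeasure.ennreal_coeFn_eq_coeFn_toMeasure] at hν
  exact_mod_cast hν

/-- The weak topology has a countable subbasis of sets `{μ | q < μ U}` with `U` open. -/
theorem exists_countable_subbasis_probabilityMeasure [SecondCountableTopology X]
    [OpensMeasurableSpace X] :
    ∃ S : Set (Set (ProbabilityMeasure X)), S.Countable ∧
      (∀ s ∈ S, ∃ U : Set X, IsOpen U ∧ ∃ q : ℝ≥0, s = {μ : ProbabilityMeasure X | q < μ U}) ∧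
      (inferInstance : TopologicalSpace (ProbabilityMeasure X)) = .generateFrom S := by
  obtain ⟨D, hDc, hD⟩ := TopologicalSpace.exists_countable_dense ℝ≥0
  obtain ⟨b, hbc, -, hb⟩ := TopologicalSpace.exists_countable_basis X
  let F : Finset (Set X) × ℝ≥0 → Set (ProbabilityMeasure X) :=
    fun p => {μ | p.2 < μ (⋃ t ∈ p.1, t)}
  have hc : ({T : Finset (Set X) | (T : Set (Set X)) ⊆ b} ×ˢ D).Countable :=
    (((Set.countable_ofPred_finite_subset hbc).preimage Finset.coe_injective).mono
      (fun T hT => show _ ∧ _ from ⟨T.finite_toSet, hT⟩)).prod hDc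
  have hopen : ∀ T : Finset (Set X), (T : Set (Set X)) ⊆ b → IsOpen (⋃ t ∈ T, t) := fun T hT =>
    isOpen_biUnion fun t ht => hb.isOpen (hT ht)
  refine ⟨F '' ({T : Finset (Set X) | (T : Set (Set X)) ⊆ b} ×ˢ D), hc.image F, ?_, ?_⟩
  · rintro _ ⟨⟨T, q⟩, ⟨hT, -⟩, rfl⟩
    exact ⟨_, hopen T hT, q, rfl⟩
  apply le_antisymm
  · refine le_generateFrom ?_
    rintro _ ⟨⟨T, q⟩, ⟨hT, -⟩, rfl⟩
    exact isOpen_setOf_lt_probabilityMeasure (hopen T hT) q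
  · set τ := TopologicalSpace.generateFrom
      (F '' ({T : Finset (Set X) | (T : Set (Set X)) ⊆ b} ×ˢ D)) with hτ
    -- The portmanteau criterion used below needs a countably generated filter; neighbourhood
    -- filters of `τ` qualify because its subbasis is countable.
    have : @SecondCountableTopology _ τ := ⟨⟨_, hc.image F, rfl⟩⟩
    refine (le_iff_nhds τ _).2 fun μ => ?_
    have : (@nhds _ τ μ).IsCountablyGenerated := inferInstance
    refine tendsto_of_forall_isOpen_le_liminf
      (μs := fun ν : ProbabilityMeasure X => ν) (L := @nhds _ τ μ) fun G hG => ?_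
    refine (le_liminf_iff (isCoboundedUnder_ge_of_le (x := 1) _ (by simp))
      (by isBoundedDefault)).2 fun r hr => ?_
    -- An open set is exhausted in measure by finite unions of basis sets, and a threshold from the
    -- dense set `D` fits strictly between; so the countable subbasis controls every open set.
    obtain ⟨T, hTb, hT, hTG⟩ := μ.exists_lt_measure_biUnion_of_isOpen (S := b)
      (fun u hu x hx => by
        obtain ⟨s, hs, hxs, hsu⟩ := hb.exists_subset_of_mem_open hx hu
        exact ⟨s, hs, (hb.isOpen hs).mem_nhds hxs, hsu⟩) hG hr
    obtain ⟨q, hq, hrq, hqT⟩ := hD.exists_between hT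
    have hTq : (T, q) ∈ {T : Finset (Set X) | (T : Set (Set X)) ⊆ b} ×ˢ D :=
      Set.mem_prod.2 ⟨hTb, hq⟩
    have hopen' : IsOpen[τ] (F (T, q)) :=
      TopologicalSpace.isOpen_generateFrom_of_mem (Set.mem_image_of_mem F hTq)
    have : F (T, q) ∈ @nhds _ τ μ := @IsOpen.mem_nhds _ τ _ _ hopen' hqT
    filter_upwards [this] with ν hν
    exact hrq.trans (lt_of_lt_of_le hν (ν.apply_mono hTG))

theorem secondCountableTopology_probabilityMeasure [SecondCountableTopology X]
    [OpensMeasurableSpace X] :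
    SecondCountableTopology (ProbabilityMeasure X) := by
  obtain ⟨S, hS, -, h⟩ := exists_countable_subbasis_probabilityMeasure (X := X)
  exact ⟨⟨S, hS, h⟩⟩

/-- With a countable subbasis, the Borel σ-algebra is generated by the subbasis itself, whose
members are superlevel sets of evaluations on open sets. -/
theorem borel_probabilityMeasure_le [SecondCountableTopology X] [BorelSpace X]
    (M : MeasurableSpace (ProbabilityMeasure X))
    (h : ∀ B : Set X, MeasurableSet B →
      Measurable[M] fun μ : ProbabilityMeasure X => (μ : Measure X) B) :
    borel (ProbabilityMeasure X) ≤ M := by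
  obtain ⟨S, hSc, hS, hgen⟩ := exists_countable_subbasis_probabilityMeasure (X := X)
  have : SecondCountableTopology (ProbabilityMeasure X) := ⟨⟨S, hSc, hgen⟩⟩
  rw [borel_eq_generateFrom_of_subbasis hgen]
  refine MeasurableSpace.generateFrom_le fun s hs => ?_
  obtain ⟨U, hU, q, rfl⟩ := hS s hs
  have := h U hU.measurableSet (measurableSet_Ioi (a := (q : ℝ≥0∞)))
  convert this using 1
  ext μ
  simp only [Set.mem_ofPred_eq, Set.mem_preimage, Set.mem_Ioi,
    ← ProbabilityMeasure.ennreal_coeFn_eq_coeFn_toMeasure]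
  norm_cast

end WeakTopology

/-! ### Recovering a measure from its integrals over a generating algebra. -/

section SubalgebraMeasurability

open scoped NNReal ENNReal BoundedContinuousFunction

variable {X : Type*} [TopologicalSpace X]

theorem BoundedContinuousFunction.aeval_apply (f : X →ᵇ ℝ) (p : Polynomial ℝ) (x : X) :
    (Polynomial.aeval f p) x = p.eval (f x) := by
  induction p using Polynomial.induction_on' with
  | add p q hp hq => simp [hp, hq]
  | monomial n a => simp [Polynomial.aeval_monomial, BoundedContinuousFunction.algebraMap_apply]

/-- Weierstrass: `χ` is a uniform limit of polynomials on the interval `[-‖f‖, ‖f‖]` containing the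
range of `f`. -/
theorem Subalgebra.mem_of_isClosed_of_comp {S : Subalgebra ℝ (X →ᵇ ℝ)}
    (hS : IsClosed (S : Set (X →ᵇ ℝ))) {f g : X →ᵇ ℝ} (hf : f ∈ S) {χ : ℝ → ℝ}
    (hχ : Continuous χ) (hg : ∀ x, g x = χ (f x)) : g ∈ S := by
  change g ∈ (S : Set (X →ᵇ ℝ))
  rw [← hS.closure_eq, Metric.mem_closure_iff]
  intro ε hε
  obtain ⟨p, hp⟩ := exists_polynomial_near_of_continuousOn (-‖f‖) ‖f‖ χ hχ.continuousOn (ε / 2)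
    (half_pos hε)
  refine ⟨Polynomial.aeval f p, ?_, ?_⟩
  · exact Algebra.adjoin_le (Set.singleton_subset_iff.2 hf)
      (Polynomial.aeval_mem_adjoin_singleton ℝ f)
  · refine lt_of_le_of_lt ((BoundedContinuousFunction.dist_le (half_pos hε).le).2 fun x => ?_)
      (half_lt_self hε)
    rw [hg, BoundedContinuousFunction.aeval_apply, dist_comm, Real.dist_eq]
    exact (hp _ (abs_le.1 (f.norm_coe_le_norm x))).le

variable [MeasurableSpace X] [OpensMeasurableSpace X]

theorem measurable_integral_of_mem_topologicalClosure {A : Subalgebra ℝ (X →ᵇ ℝ)}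
    {M : MeasurableSpace (ProbabilityMeasure X)}
    (h : ∀ f ∈ A, Measurable[M] fun μ : ProbabilityMeasure X => ∫ x, f x ∂(μ : Measure X))
    {f : X →ᵇ ℝ} (hf : f ∈ A.topologicalClosure) :
    Measurable[M] fun μ : ProbabilityMeasure X => ∫ x, f x ∂(μ : Measure X) := by
  obtain ⟨u, huA, hu⟩ := mem_closure_iff_seq_limit.1 (show f ∈ closure (A : Set (X →ᵇ ℝ)) from hf)
  refine measurable_of_tendsto_metrizable (fun n => h (u n) (huA n)) (tendsto_pi_nhds.2 fun μ => ?_)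
  rw [tendsto_iff_dist_tendsto_zero] at hu ⊢
  refine squeeze_zero (fun _ => dist_nonneg) (fun n => ?_) hu
  rw [dist_eq_norm, ← integral_sub ((u n).integrable _) (f.integrable _)]
  refine (norm_integral_le_of_norm_le_const (C := dist (u n) f) (ae_of_all _ fun x => ?_)).trans ?_
  · rw [← dist_eq_norm]
    exact BoundedContinuousFunction.dist_coe_le_dist x
  · simp

/-- The positive part, cut off at `1` after scaling by `n`. -/
def BoundedContinuousFunction.cutoff (f : X →ᵇ ℝ) (n : ℕ) : X →ᵇ ℝ :=
  BoundedContinuousFunction.ofNormedAddCommGroup (fun x => min 1 (n * max (f x) 0))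
    (by fun_prop) 1 fun x => by
      have : 0 ≤ min 1 (n * max (f x) 0) := by positivity
      rw [Real.norm_of_nonneg this]
      exact min_le_left _ _

/-- If the integrals of the functions of an algebra generating the σ-algebra are measurable, then
so are the measures of sets. -/
theorem measurable_toMeasure_of_subalgebra {A : Subalgebra ℝ (X →ᵇ ℝ)}
    (hA : (inferInstance : MeasurableSpace X) ≤ ⨆ f : A, (borel ℝ).comap (f : X →ᵇ ℝ))
    {M : MeasurableSpace (ProbabilityMeasure X)}
    (h : ∀ f ∈ A, Measurable[M] fun μ : ProbabilityMeasure X => ∫ x, f x ∂(μ : Measure X)) :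
    Measurable[M] fun μ : ProbabilityMeasure X => (μ : Measure X) := by
  set S := A.topologicalClosure with hS
  have hcl : IsClosed (S : Set (X →ᵇ ℝ)) := A.isClosed_topologicalClosure
  -- Positivity sets form a π-system: products of cutoffs realise intersections. Subtracting
  -- constants shows that they generate the σ-algebra.
  let P : Set (Set X) := {s | ∃ f ∈ S, s = {x | 0 < f x}}
  refine Measurable.measure_of_isPiSystem_of_isProbabilityMeasure (S := P) ?_ ?_ ?_
  · apply le_antisymm
    · refine hA.trans (iSup_le fun f => ?_)
      rw [borel_eq_generateFrom_Ioi, MeasurableSpace.comap_generateFrom]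
      refine MeasurableSpace.generateFrom_mono ?_
      rintro _ ⟨_, ⟨a, rfl⟩, rfl⟩
      refine ⟨f - algebraMap ℝ _ a, S.sub_mem (A.le_topologicalClosure f.2)
        (S.algebraMap_mem a), ?_⟩
      ext x
      simp [BoundedContinuousFunction.algebraMap_apply]
    · refine MeasurableSpace.generateFrom_le ?_
      rintro _ ⟨f, -, rfl⟩
      exact (isOpen_lt continuous_const f.continuous).measurableSet
  · rintro _ ⟨f, hf, rfl⟩ _ ⟨g, hg, rfl⟩ -
    refine ⟨f.cutoff 1 * g.cutoff 1, S.mul_mem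
      (Subalgebra.mem_of_isClosed_of_comp hcl hf (χ := fun y => min 1 ((1 : ℕ) * max y 0))
        (by fun_prop) fun x => rfl)
      (Subalgebra.mem_of_isClosed_of_comp hcl hg (χ := fun y => min 1 ((1 : ℕ) * max y 0))
        (by fun_prop) fun x => rfl), ?_⟩
    ext x
    change 0 < f x ∧ 0 < g x ↔
      0 < min 1 ((1 : ℕ) * max (f x) 0) * min 1 ((1 : ℕ) * max (g x) 0)
    have aux : ∀ y : ℝ, 0 < y ↔ 0 < min 1 ((1 : ℕ) * max y 0) := fun y => by simp
    constructor
    · exact fun h => mul_pos ((aux _).1 h.1) ((aux _).1 h.2)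
    · intro h
      have h1 : 0 ≤ min 1 ((1 : ℕ) * max (f x) 0) := by positivity
      have h2 : 0 ≤ min 1 ((1 : ℕ) * max (g x) 0) := by positivity
      exact ⟨(aux _).2 (pos_of_mul_pos_left h h2), (aux _).2 (pos_of_mul_pos_right h h1)⟩
  · rintro _ ⟨f, hf, rfl⟩
    have hmeas : MeasurableSet {x | 0 < f x} :=
      (isOpen_lt continuous_const f.continuous).measurableSet
    -- The indicator of `{0 < f}` is the pointwise limit of the cutoffs `min 1 (n f⁺)`, which stay
    -- in the closed algebra.
    have key : Measurable[M] fun μ : ProbabilityMeasure X =>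
        (μ : Measure X).real {x | 0 < f x} := by
      refine measurable_of_tendsto_metrizable
        (f := fun (n : ℕ) (μ : ProbabilityMeasure X) => ∫ x, f.cutoff n x ∂(μ : Measure X))
        (fun n => measurable_integral_of_mem_topologicalClosure h
          (Subalgebra.mem_of_isClosed_of_comp hcl hf (χ := fun y => min 1 (n * max y 0))
            (by fun_prop) fun x => rfl)) (tendsto_pi_nhds.2 fun μ => ?_)
      rw [← integral_indicator_one hmeas]
      refine tendsto_integral_of_dominated_convergence (fun _ => 1)
        (fun n => (f.cutoff n).continuous.measurable.aestronglyMeasurable)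
        (integrable_const _) (fun n => ae_of_all _ fun x => ?_) (ae_of_all _ fun x => ?_)
      · have : 0 ≤ min 1 (n * max (f x) 0) := by positivity
        change ‖min 1 (n * max (f x) 0)‖ ≤ 1
        rw [Real.norm_of_nonneg this]
        exact min_le_left _ _
      · change Tendsto (fun n : ℕ => min 1 (n * max (f x) 0)) atTop _
        by_cases hx : 0 < f x
        · rw [Set.indicator_of_mem (by exact hx), Pi.one_apply]
          refine tendsto_const_nhds.congr' ?_
          obtain ⟨N, hN⟩ := exists_nat_gt (1 / f x)
          filter_upwards [eventually_ge_atTop N] with n hn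
          rw [max_eq_left hx.le, min_eq_left]
          rw [div_lt_iff₀ hx] at hN
          refine hN.le.trans (mul_le_mul_of_nonneg_right (by exact_mod_cast hn) hx.le)
        · rw [Set.indicator_of_notMem (by exact hx), max_eq_right (not_lt.1 hx)]
          simp
    have := key.ennreal_ofReal
    simpa only [Measure.real, ENNReal.ofReal_toReal (measure_ne_top _ _)] using this

end SubalgebraMeasurability

/-! ### Norm continuity of Bochner integrals under weak convergence. -/

section BochnerContinuity

open scoped BoundedContinuousFunction

variable {X : Type*} [TopologicalSpace X] [SecondCountableTopology X] [MeasurableSpace X]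
  [OpensMeasurableSpace X] {B : Type*} [NormedAddCommGroup B]

theorem integrable_of_continuous_of_norm_le {F : X → B} (hF : Continuous F) {R : ℝ}
    (hR : ∀ x, ‖F x‖ ≤ R) (μ : ProbabilityMeasure X) : Integrable F (μ : Measure X) :=
  Integrable.of_bound hF.stronglyMeasurable.aestronglyMeasurable R (ae_of_all _ hR)

/-- Up to an arbitrarily small error, a continuous function into a normed space is a finite
combination of bounded continuous functions. -/
theorem exists_partition_of_continuous {F : X → B} (hF : Continuous F)
    (μ : ProbabilityMeasure X) {ε : ℝ} (hε : 0 < ε) :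
    ∃ (n : ℕ) (y : ℕ → B) (θ : ℕ → (X →ᵇ ℝ)) (h : X →ᵇ ℝ),
      (∀ i x, 0 ≤ θ i x) ∧ (∀ x, 0 ≤ h x) ∧ (∀ x, ∑ i ∈ Finset.range n, θ i x + h x = 1) ∧
      (∀ i x, θ i x * ‖F x - y i‖ ≤ θ i x * ε) ∧ ∫ x, h x ∂(μ : Measure X) < ε := by
  have hne : Nonempty X := μ.nonempty
  let y : ℕ → B := fun i => F (TopologicalSpace.denseSeq X i)
  -- A bump supported where `F` is within `ε` of `y i`. The values `y i` are dense in the range of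
  -- `F`, so at every point some bump is positive.
  let ψ : ℕ → X → ℝ := fun i x => max 0 (1 - ‖F x - y i‖ / ε)
  have hψ0 : ∀ i x, 0 ≤ ψ i x := fun i x => le_max_left _ _
  have hψ1 : ∀ i x, ψ i x ≤ 1 := fun i x => max_le zero_le_one (by
    have : 0 ≤ ‖F x - y i‖ / ε := by positivity
    linarith)
  have hψc : ∀ i, Continuous (ψ i) := fun i => by fun_prop
  have hψε : ∀ i x, ψ i x * ‖F x - y i‖ ≤ ψ i x * ε := fun i x => by
    rcases le_or_gt ‖F x - y i‖ ε with hx | hx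
    · exact mul_le_mul_of_nonneg_left hx (hψ0 i x)
    · have : ψ i x = 0 := max_eq_left (by
        have : 1 ≤ ‖F x - y i‖ / ε := (one_le_div hε).2 hx.le
        linarith)
      simp [this]
  -- Normalising `n ψ i` by `d n` leaves the remainder `1 / d n`. The added `1` avoids division by
  -- zero, and the factor `n` drives the remainder to `0` at every point.
  let d : ℕ → X → ℝ := fun n x => 1 + n * ∑ i ∈ Finset.range n, ψ i x
  have hd1 : ∀ n x, 1 ≤ d n x := fun n x => by
    have : 0 ≤ ∑ i ∈ Finset.range n, ψ i x := Finset.sum_nonneg fun i _ => hψ0 i x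
    have : 0 ≤ n * ∑ i ∈ Finset.range n, ψ i x := by positivity
    simp only [d]
    linarith
  have hdpos : ∀ n x, 0 < d n x := fun n x => lt_of_lt_of_le one_pos (hd1 n x)
  have hdc : ∀ n, Continuous (d n) := fun n => by fun_prop
  let h : ℕ → X →ᵇ ℝ := fun n => BoundedContinuousFunction.ofNormedAddCommGroup
    (fun x => (d n x)⁻¹) ((hdc n).inv₀ fun x => (hdpos n x).ne') 1 fun x => by
      rw [Real.norm_of_nonneg (inv_nonneg.2 (hdpos n x).le)]
      exact inv_le_one_of_one_le₀ (hd1 n x)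
  let θ : ℕ → ℕ → X →ᵇ ℝ := fun n i => BoundedContinuousFunction.ofNormedAddCommGroup
    (fun x => n * ψ i x * (d n x)⁻¹)
    ((continuous_const.mul (hψc i)).mul ((hdc n).inv₀ fun x => (hdpos n x).ne')) n fun x => by
      have h0 := inv_nonneg.2 (hdpos n x).le
      have h1 := inv_le_one_of_one_le₀ (hd1 n x)
      have h2 := hψ0 i x
      rw [Real.norm_of_nonneg (by positivity)]
      calc (n : ℝ) * ψ i x * (d n x)⁻¹ ≤ n * 1 * 1 := by gcongr; exact hψ1 i x
        _ = n := by ring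
  have hlim : Tendsto (fun n => ∫ x, h n x ∂(μ : Measure X)) atTop (𝓝 0) := by
    rw [← integral_zero X ℝ (μ := (μ : Measure X))]
    refine tendsto_integral_of_dominated_convergence (fun _ => 1)
      (fun n => (h n).continuous.measurable.aestronglyMeasurable) (integrable_const _)
      (fun n => ae_of_all _ fun x => ?_) (ae_of_all _ fun x => ?_)
    · change ‖(d n x)⁻¹‖ ≤ 1
      rw [Real.norm_of_nonneg (inv_nonneg.2 (hdpos n x).le)]
      exact inv_le_one_of_one_le₀ (hd1 n x)
    · change Tendsto (fun n => (d n x)⁻¹) atTop (𝓝 0)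
      refine tendsto_inv_atTop_zero.comp ?_
      obtain ⟨i, hi⟩ : ∃ i, ‖F x - y i‖ < ε := by
        have hopen : IsOpen {z | ‖F x - F z‖ < ε} := isOpen_lt (by fun_prop) continuous_const
        obtain ⟨i, hi⟩ := (TopologicalSpace.denseRange_denseSeq X).exists_mem_open hopen
          ⟨x, by simpa using hε⟩
        exact ⟨i, hi⟩
      have hpos : 0 < ψ i x := lt_max_of_lt_right (by
        have : ‖F x - y i‖ / ε < 1 := (div_lt_one hε).2 hi
        linarith)
      refine tendsto_atTop_mono' _ ?_
        ((tendsto_natCast_atTop_atTop (R := ℝ)).atTop_mul_const hpos)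
      filter_upwards [eventually_gt_atTop i] with n hn
      have : ψ i x ≤ ∑ j ∈ Finset.range n, ψ j x :=
        Finset.single_le_sum (f := fun j => ψ j x) (fun j _ => hψ0 j x) (Finset.mem_range.2 hn)
      have : n * ψ i x ≤ n * ∑ j ∈ Finset.range n, ψ j x := by gcongr
      simp only [d]
      linarith
  obtain ⟨n, hn⟩ := ((tendsto_order.1 hlim).2 ε hε).exists
  refine ⟨n, y, θ n, h n, fun i x => ?_, fun x => inv_nonneg.2 (hdpos n x).le, fun x => ?_,
    fun i x => ?_, hn⟩
  · have h0 := inv_nonneg.2 (hdpos n x).le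
    have h2 := hψ0 i x
    change 0 ≤ n * ψ i x * (d n x)⁻¹
    positivity
  · change ∑ i ∈ Finset.range n, n * ψ i x * (d n x)⁻¹ + (d n x)⁻¹ = 1
    rw [← Finset.sum_mul, ← Finset.mul_sum, ← add_one_mul, add_comm]
    exact mul_inv_cancel₀ (hdpos n x).ne'
  · change n * ψ i x * (d n x)⁻¹ * _ ≤ n * ψ i x * (d n x)⁻¹ * _
    have h0 := inv_nonneg.2 (hdpos n x).le
    calc n * ψ i x * (d n x)⁻¹ * ‖F x - y i‖
        = n * (d n x)⁻¹ * (ψ i x * ‖F x - y i‖) := by ring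
      _ ≤ n * (d n x)⁻¹ * (ψ i x * ε) := by
          have := hψε i x
          gcongr
      _ = n * ψ i x * (d n x)⁻¹ * ε := by ring

/-- The Bochner integral of a bounded continuous function with values in a Banach space depends
continuously, in norm, on the probability measure. -/
theorem continuous_integral_probabilityMeasure [NormedSpace ℝ B] [CompleteSpace B]
    {F : X → B} (hF : Continuous F) {R : ℝ}
    (hR : ∀ x, ‖F x‖ ≤ R) :
    Continuous fun μ : ProbabilityMeasure X => ∫ x, F x ∂(μ : Measure X) := by
  refine continuous_iff_continuousAt.2 fun μ => Metric.tendsto_nhds.2 fun δ hδ => ?_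
  have hR0 : 0 ≤ R := (norm_nonneg _).trans (hR μ.nonempty.some)
  have hRp : 0 < 2 * R + 3 := by linarith
  -- The final triangle inequality costs `(1 + R) ε` twice and `ε` once.
  set ε := δ / (2 * R + 3) with hεd
  have hε : 0 < ε := div_pos hδ hRp
  obtain ⟨n, y, θ, h, hθ0, hh0, hsum, hθε, hhμ⟩ := exists_partition_of_continuous hF μ hε
  let G : ProbabilityMeasure X → B := fun ν =>
    ∑ i ∈ Finset.range n, (∫ x, θ i x ∂(ν : Measure X)) • y i
  have hint : ∀ f : X →ᵇ ℝ,
      Continuous fun ν : ProbabilityMeasure X => ∫ x, f x ∂(ν : Measure X) := fun f =>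
    ProbabilityMeasure.continuous_integral_boundedContinuousFunction f
  have hG : Continuous G := continuous_finsetSum _ fun i _ => (hint (θ i)).smul continuous_const
  have key : ∀ ν : ProbabilityMeasure X, ‖∫ x, F x ∂(ν : Measure X) - G ν‖ ≤
      ε + R * ∫ x, h x ∂(ν : Measure X) := by
    intro ν
    have hGi : G ν = ∫ x, ∑ i ∈ Finset.range n, θ i x • y i ∂(ν : Measure X) := by
      rw [integral_finsetSum _ fun i _ => ((θ i).integrable _).smul_const _]
      exact Finset.sum_congr rfl fun i _ => (integral_smul_const _ _).symm
    have hi : Integrable (fun x => ε + R * h x) (ν : Measure X) :=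
      (integrable_const ε).add ((h.integrable _).const_mul R)
    rw [hGi, ← integral_sub (integrable_of_continuous_of_norm_le hF hR ν)
      (integrable_finsetSum _ fun i _ => ((θ i).integrable _).smul_const _)]
    calc _ ≤ ∫ x, (ε + R * h x) ∂(ν : Measure X) :=
          norm_integral_le_of_norm_le hi (ae_of_all _ fun x => ?_)
      _ = _ := by
          rw [integral_add (integrable_const ε) ((h.integrable _).const_mul R),
            integral_const_mul]
          simp
    have e : F x - ∑ i ∈ Finset.range n, θ i x • y i =
        ∑ i ∈ Finset.range n, θ i x • (F x - y i) + h x • F x := by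
      simp only [smul_sub, Finset.sum_sub_distrib, ← Finset.sum_smul]
      rw [sub_add_eq_add_sub, ← add_smul, hsum, one_smul]
    rw [e]
    refine (norm_add_le _ _).trans (add_le_add ?_ ?_)
    · refine (norm_sum_le _ _).trans ?_
      calc ∑ i ∈ Finset.range n, ‖θ i x • (F x - y i)‖
          ≤ ∑ i ∈ Finset.range n, θ i x * ε := Finset.sum_le_sum fun i _ => by
            rw [norm_smul, Real.norm_of_nonneg (hθ0 i x)]
            exact hθε i x
        _ ≤ ε := by
            rw [← Finset.sum_mul]
            have := hsum x
            have := hh0 x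
            nlinarith
    · rw [norm_smul, Real.norm_of_nonneg (hh0 x), mul_comm]
      exact mul_le_mul_of_nonneg_right (hR x) (hh0 x)
  -- The remainder `h` is itself bounded and continuous, so its smallness under `μ` persists for
  -- nearby `ν`; this takes the place of tightness.
  filter_upwards [(tendsto_order.1 ((hint h).tendsto μ)).2 ε hhμ,
    Metric.tendsto_nhds.1 (hG.tendsto μ) ε hε] with ν hν hGν
  have h1 : dist (∫ x, F x ∂(ν : Measure X)) (G ν) ≤ ε + R * ε := by
    rw [dist_eq_norm]
    exact (key ν).trans (by gcongr)
  have h2 : dist (∫ x, F x ∂(μ : Measure X)) (G μ) ≤ ε + R * ε := by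
    rw [dist_eq_norm]
    exact (key μ).trans (by gcongr)
  have h3 : (2 * R + 3) * ε = δ := by rw [hεd]; field_simp
  calc dist (∫ x, F x ∂(ν : Measure X)) (∫ x, F x ∂(μ : Measure X))
      ≤ dist (∫ x, F x ∂(ν : Measure X)) (G ν) + dist (G ν) (G μ) +
        dist (G μ) (∫ x, F x ∂(μ : Measure X)) := dist_triangle4 _ _ _ _
    _ < (ε + R * ε) + ε + (ε + R * ε) := by rw [dist_comm (G μ)]; linarith
    _ = δ := by linarith

end BochnerContinuity

/-! ### The cylindrical σ-algebra of a separable normed space. -/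

section CylinderSigmaAlgebra

variable {V : Type*} [NormedAddCommGroup V] [NormedSpace ℝ V]

/-- The Borel σ-algebra of a separable normed space is generated by the continuous functionals. -/
theorem borel_le_iSup_comap_dual [SecondCountableTopology V] :
    borel V ≤ ⨆ l : V →L[ℝ] ℝ, (borel ℝ).comap l := by
  set M : MeasurableSpace V := ⨆ l : V →L[ℝ] ℝ, (borel ℝ).comap l with hM
  have hl : ∀ l : V →L[ℝ] ℝ, Measurable[M] l := fun l =>
    (comap_measurable l).mono (le_iSup (fun l : V →L[ℝ] ℝ => (borel ℝ).comap l) l) le_rfl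
  choose g hg1 hg using fun v : V => exists_dual_vector'' ℝ v
  -- Functionals norming a dense sequence already compute every norm, so norms are countable suprema
  -- of measurable functions. Balls are then measurable, and open sets are countable unions of
  -- balls.
  have hnorm : ∀ v x : V, ‖x - v‖ = ⨆ n, g (TopologicalSpace.denseSeq V n) (x - v) := by
    intro v x
    have hbd : ∀ n, g (TopologicalSpace.denseSeq V n) (x - v) ≤ ‖x - v‖ := fun n =>
      (le_abs_self _).trans (((g _).le_opNorm _).trans
        (mul_le_of_le_one_left (norm_nonneg _) (hg1 _)))
    refine le_antisymm (le_of_forall_pos_le_add fun ε hε => ?_) (ciSup_le hbd)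
    obtain ⟨n, hn⟩ := (TopologicalSpace.denseRange_denseSeq V).exists_mem_open
      (Metric.isOpen_ball (x := x - v) (ε := ε / 2)) ⟨x - v, Metric.mem_ball_self (half_pos hε)⟩
    set z := TopologicalSpace.denseSeq V n with hz
    rw [Metric.mem_ball, dist_eq_norm] at hn
    have h1 : ‖x - v‖ ≤ ‖z‖ + ‖z - (x - v)‖ := by
      have := norm_sub_le z (z - (x - v))
      rwa [sub_sub_cancel] at this
    have h2 : ‖z‖ - ‖z - (x - v)‖ ≤ g z (x - v) := by
      have h3 : g z (z - (x - v)) ≤ ‖z - (x - v)‖ := (le_abs_self _).trans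
        (((g _).le_opNorm _).trans (mul_le_of_le_one_left (norm_nonneg _) (hg1 _)))
      rw [map_sub, hg z] at h3
      simp only [RCLike.ofReal_real_eq_id, id_eq] at h3
      linarith
    have h4 := le_ciSup (f := fun n => g (TopologicalSpace.denseSeq V n) (x - v))
      ⟨_, Set.forall_mem_range.2 hbd⟩ n
    simp only [← hz] at h4
    linarith
  have hball : ∀ v r, MeasurableSet[M] (Metric.ball v r) := by
    intro v r
    have : Measurable[M] fun x => ‖x - v‖ := by
      simp only [hnorm, map_sub]
      exact Measurable.iSup fun n => (hl _).sub_const _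
    have := this (measurableSet_Iio (a := r))
    convert this using 1
    ext x
    simp [dist_eq_norm]
  refine MeasurableSpace.generateFrom_le fun U hU => ?_
  have hU : IsOpen U := hU
  choose! r hr hrU using fun x (hx : x ∈ U) => Metric.isOpen_iff.1 hU x hx
  obtain ⟨s, hs, hsU⟩ := TopologicalSpace.isOpen_iUnion_countable
    (fun x : U => Metric.ball (x : V) (r x)) fun x => Metric.isOpen_ball
  have : U = ⋃ x ∈ s, Metric.ball (x : V) (r x) := by
    rw [hsU]
    refine Set.Subset.antisymm (fun x hx => Set.mem_iUnion.2
      ⟨⟨x, hx⟩, Metric.mem_ball_self (hr x hx)⟩) (Set.iUnion_subset fun x => hrU x x.2)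
  rw [this]
  exact MeasurableSet.biUnion hs fun x _ => hball _ _

end CylinderSigmaAlgebra

/-! ### Continuity of the signature in the `ℓ¹` tensor norm. -/

section SignatureContinuity

variable {E : Type u} [NormedAddCommGroup E] [NormedSpace ℝ E] (N : AdmissibleNorms E)

theorem nrm_tprod_le {m : ℕ} (v : Fin m → E) :
    N.nrm m (PiTensorProduct.tprod ℝ v) ≤ ∏ i, ‖v i‖ := by
  induction m with
  | zero =>
    have h : PiTensorProduct.tprod ℝ v = (TensorPower.algebraMap₀ 1 : ⨂[ℝ]^0 E) := by
      rw [TensorPower.algebraMap₀_one, TensorPower.gOne_def]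
      congr 1
      exact Subsingleton.elim _ _
    rw [h, N.nrm_zero]
    simp
  | succ m ih =>
    have h : PiTensorProduct.tprod ℝ v =
        TensorPower.mulEquiv ((PiTensorProduct.tprod ℝ fun i : Fin m => v i.castSucc) ⊗ₜ[ℝ]
          (PiTensorProduct.tprod ℝ fun _ : Fin 1 => v (Fin.last m))) := by
      rw [← TensorPower.gMul_def, TensorPower.tprod_mul_tprod]
      congr 1
      ext i
      refine Fin.lastCases ?_ (fun j => ?_) i
      · exact (Fin.append_right (fun i : Fin m => v i.castSucc)
          (fun _ : Fin 1 => v (Fin.last m)) (0 : Fin 1)).symm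
      · exact (Fin.append_left (fun i : Fin m => v i.castSucc)
          (fun _ : Fin 1 => v (Fin.last m)) j).symm
    rw [h, Fin.prod_univ_castSucc]
    refine (N.nrm_mul_le _ _ _ _).trans ?_
    rw [N.nrm_one]
    exact mul_le_mul_of_nonneg_right (ih _) (norm_nonneg _)

/-- The identification of a tensor with an element of the normed tensor power. -/
def toTensorPow (m : ℕ) : ⨂[ℝ]^m E →ₗ[ℝ] TensorPow N m := LinearMap.id

theorem continuous_tensorExp (m : ℕ) :
    Continuous fun v : E => toTensorPow N m (tensorExp v m) := by
  let t : MultilinearMap ℝ (fun _ : Fin m => E) (TensorPow N m) :=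
    (toTensorPow N m).compMultilinearMap (PiTensorProduct.tprod ℝ)
  have ht : Continuous t := (t.mkContinuous 1 fun v => by
    rw [one_mul]
    exact nrm_tprod_le N v).cont
  have hd : Continuous fun v : E => t fun _ => v := ht.comp (continuous_pi fun _ => continuous_id)
  exact hd.const_smul ((m ! : ℝ)⁻¹)

/-- The tensor product as a continuous bilinear map. -/
def tensorMul (i j : ℕ) : TensorPow N i →L[ℝ] TensorPow N j →L[ℝ] TensorPow N (i + j) :=
  LinearMap.mkContinuous₂
    (show TensorPow N i →ₗ[ℝ] TensorPow N j →ₗ[ℝ] TensorPow N (i + j) from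
      (TensorProduct.mk ℝ (⨂[ℝ]^i E) (⨂[ℝ]^j E)).compr₂
        ((toTensorPow N (i + j)).comp TensorPower.mulEquiv.toLinearMap))
    1 fun a b => by
      rw [one_mul]
      exact N.nrm_mul_le i j a b

variable {X : Type*} [TopologicalSpace X]

/-- Families of tensor series that are continuous in each degree and whose norms are locally
dominated by a summable sequence. -/
def IsLocallyDominated (s : X → (m : ℕ) → ⨂[ℝ]^m E) : Prop :=
  (∀ m, Continuous fun x => toTensorPow N m (s x m)) ∧
    ∀ x₀, ∃ b : ℕ → ℝ, Summable b ∧ ∀ᶠ x in 𝓝 x₀, ∀ m, N.nrm m (s x m) ≤ b m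

variable {N}

theorem isLocallyDominated_tensorOne :
    IsLocallyDominated N fun _ : X => (tensorOne : (m : ℕ) → ⨂[ℝ]^m E) :=
  ⟨fun _ => continuous_const, fun _ =>
    ⟨_, summable_tensorOne N, Eventually.of_forall fun _ _ => le_rfl⟩⟩

theorem isLocallyDominated_tensorExp {f : X → E} (hf : Continuous f) :
    IsLocallyDominated N fun x => tensorExp (f x) := by
  refine ⟨fun m => (continuous_tensorExp N m).comp hf, fun x₀ =>
    ⟨_, Real.summable_pow_div_factorial (‖f x₀‖ + 1), ?_⟩⟩
  filter_upwards [(tendsto_order.1 (hf.norm.tendsto x₀)).2 _ (lt_add_one ‖f x₀‖)] with x hx m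
  rw [tensorExp, map_smul_eq_mul, Real.norm_of_nonneg (by positivity), div_eq_inv_mul]
  refine mul_le_mul_of_nonneg_left ((nrm_pow_le N _ m).trans ?_) (by positivity)
  exact pow_le_pow_left₀ (norm_nonneg _) hx.le m

/-- The Cauchy product of the two dominating sequences is summable and dominates. -/
theorem IsLocallyDominated.tensorConv {s t : X → (m : ℕ) → ⨂[ℝ]^m E}
    (hs : IsLocallyDominated N s) (ht : IsLocallyDominated N t) :
    IsLocallyDominated N fun x => tensorConv (s x) (t x) := by
  refine ⟨fun m => ?_, fun x₀ => ?_⟩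
  · have cast_cont : ∀ {k : ℕ} (h : k = m) (a : X → ⨂[ℝ]^k E),
        Continuous (fun x => toTensorPow N k (a x)) →
        Continuous fun x => toTensorPow N m (TensorPower.cast ℝ E h (a x)) := by
      intro k h a ha
      subst h
      simpa only [TensorPower.cast_refl, LinearEquiv.refl_apply] using ha
    simp only [_root_.tensorConv, map_sum]
    refine continuous_finsetSum _ fun p _ => cast_cont _ _ ?_
    exact ((tensorMul N p.1.1 p.1.2).continuous.comp (hs.1 p.1.1)).clm_apply (ht.1 p.1.2)
  · obtain ⟨b, hb, hbs⟩ := hs.2 x₀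
    obtain ⟨c, hc, hct⟩ := ht.2 x₀
    have hb0 : 0 ≤ b := fun m => (apply_nonneg (N.nrm m) _).trans (hbs.self_of_nhds m)
    have hc0 : 0 ≤ c := fun m => (apply_nonneg (N.nrm m) _).trans (hct.self_of_nhds m)
    refine ⟨_, summable_antidiagonal_mul hb hc hb0 hc0, ?_⟩
    filter_upwards [hbs, hct] with x hx hx' m
    refine (nrm_tensorConv_le N _ _ m).trans (Finset.sum_le_sum fun p _ => ?_)
    exact mul_le_mul (hx _) (hx' _) (apply_nonneg _ _) (hb0 _)

/-- Dominated convergence for the series `∑ ‖s x m - s x₀ m‖`, which is the `ℓ¹` distance. -/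
theorem IsLocallyDominated.continuous {s : X → (m : ℕ) → ⨂[ℝ]^m E}
    (hs : IsLocallyDominated N s) {F : X → TensorSeries N}
    (hF : ∀ x m, (F x : (m : ℕ) → UniformSpace.Completion (TensorPow N m)) m =
      TensorPow.incl N m (s x m)) : Continuous F := by
  refine continuous_iff_continuousAt.2 fun x₀ => ?_
  rw [ContinuousAt, tendsto_iff_norm_sub_tendsto_zero]
  obtain ⟨b, hb, hbs⟩ := hs.2 x₀
  have hsub : ∀ x m, ‖(F x - F x₀ : TensorSeries N) m‖ =
      ‖toTensorPow N m (s x m) - toTensorPow N m (s x₀ m)‖ := fun x m => by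
    rw [lp.coeFn_sub, Pi.sub_apply, hF, hF]
    refine Eq.trans ?_ (UniformSpace.Completion.norm_coe (E := TensorPow N m) _)
    rw [UniformSpace.Completion.coe_sub]
    rfl
  have hnorm : ∀ x, ‖F x - F x₀‖ =
      ∑' m, ‖toTensorPow N m (s x m) - toTensorPow N m (s x₀ m)‖ := fun x => by
    rw [lp.norm_eq_tsum_rpow (by simp)]
    simp only [ENNReal.toReal_one, Real.rpow_one, div_one, hsub]
  simp only [hnorm]
  have h0 : (∑' _ : ℕ, (0 : ℝ)) = 0 := tsum_zero
  rw [← h0]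
  refine tendsto_tsum_of_dominated_convergence (hb.add hb) (fun m => ?_) ?_
  · have := ((hs.1 m).sub (continuous_const (y := toTensorPow N m (s x₀ m)))).norm.tendsto x₀
    simpa using this
  · filter_upwards [hbs] with x hx m
    rw [norm_norm]
    exact (norm_sub_le _ _).trans (add_le_add (hx m) (hbs.self_of_nhds m))

variable {T : ℕ} {W : Type u} [NormedAddCommGroup W] [NormedSpace ℝ W]

theorem continuous_increment (t : Fin (T + 1)) : Continuous fun x : DPath T W => increment x t := by
  refine (WithLp.prod_continuous_toLp 1 ℝ W).comp (continuous_const.prodMk ?_)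
  refine Fin.cases ?_ (fun s => ?_) t
  · exact continuous_apply (A := fun _ : Fin (T + 1) => W) 0
  · exact (continuous_apply (A := fun _ : Fin (T + 1) => W) s.succ).sub
      (continuous_apply (A := fun _ : Fin (T + 1) => W) s.castSucc)

theorem isLocallyDominated_sigComponents (N : AdmissibleNorms (TimeExt W)) :
    IsLocallyDominated N fun x : DPath T W => sigComponents x := by
  have key : ∀ l : List (DPath T W → (m : ℕ) → ⨂[ℝ]^m (TimeExt W)),
      (∀ s ∈ l, IsLocallyDominated N s) →
        IsLocallyDominated N fun x => (l.map fun s => s x).foldr tensorConv tensorOne := by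
    intro l
    induction l with
    | nil => intro _; exact isLocallyDominated_tensorOne
    | cons s l ih =>
      intro h
      exact (h s (by simp)).tensorConv (ih fun s' hs' => h s' (by simp [hs']))
  have h := key (List.ofFn fun (t : Fin (T + 1)) (x : DPath T W) => tensorExp (increment x t))
    fun s hs => by
      obtain ⟨t, rfl⟩ := List.mem_ofFn.mp hs
      exact isLocallyDominated_tensorExp (continuous_increment t)
  simp only [List.map_ofFn] at h
  exact h

theorem continuous_signature (N : AdmissibleNorms (TimeExt W)) :
    Continuous (signature N : DPath T W → UnitTensorSeries N) :=
  ((isLocallyDominated_sigComponents N).continuous fun _ _ => rfl).subtype_mk _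

theorem continuous_robustSignature (c : SignatureScheme W) :
    Continuous (robustSignature c : DPath T W → TensorSeries c.norms) :=
  c.normalization.continuous_toFun.comp (continuous_signature c.norms)

end SignatureContinuity

/-! ### Shuffles and deconcatenation of words. -/

section Shuffle

variable {α : Type*}

/-- The list of all shuffles of two words. -/
def wordShuffles : List α → List α → List (List α)
  | [], w => [w]
  | a :: u, [] => [a :: u]
  | a :: u, b :: w => (wordShuffles u (b :: w)).map (List.cons a) ++
      (wordShuffles (a :: u) w).map (List.cons b)
termination_by u w => u.length + w.length

/-- The sum of a function over the shuffles of two words. -/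
def shuffleSum (f : List α → ℝ) (u w : List α) : ℝ := ((wordShuffles u w).map f).sum

theorem shuffleSum_nil_left (f : List α → ℝ) (w : List α) : shuffleSum f [] w = f w := by
  simp [shuffleSum, wordShuffles]

theorem shuffleSum_nil_right (f : List α → ℝ) (u : List α) : shuffleSum f u [] = f u := by
  cases u <;> simp [shuffleSum, wordShuffles]

theorem shuffleSum_cons_cons (f : List α → ℝ) (a b : α) (u w : List α) :
    shuffleSum f (a :: u) (b :: w) =
      shuffleSum (fun v => f (a :: v)) u (b :: w) + shuffleSum (fun v => f (b :: v)) (a :: u) w := by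
  rw [shuffleSum, wordShuffles, List.map_append, List.sum_append, List.map_map, List.map_map]
  rfl

theorem shuffleSum_add (f g : List α → ℝ) (u w : List α) :
    shuffleSum (fun v => f v + g v) u w = shuffleSum f u w + shuffleSum g u w :=
  List.sum_map_add

theorem shuffleSum_const_mul (c : ℝ) (f : List α → ℝ) (u w : List α) :
    shuffleSum (fun v => c * f v) u w = c * shuffleSum f u w :=
  List.sum_map_mul_left _ _ _

theorem length_of_mem_wordShuffles {u w v : List α} (hv : v ∈ wordShuffles u w) :
    v.length = u.length + w.length := by
  induction u, w using wordShuffles.induct generalizing v with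
  | case1 w => simp_all [wordShuffles]
  | case2 a u => simp_all [wordShuffles]
  | case3 a u b w ih1 ih2 =>
    rw [wordShuffles, List.mem_append, List.mem_map, List.mem_map] at hv
    rcases hv with ⟨v, hv, rfl⟩ | ⟨v, hv, rfl⟩
    · simp only [List.length_cons, ih1 hv]
      omega
    · simp only [List.length_cons, ih2 hv]
      omega

/-- The convolution of functions on words dual to deconcatenation. -/
def wordConv (f g : List α → ℝ) : List α → ℝ
  | [] => f [] * g []
  | a :: w => f [] * g (a :: w) + wordConv (fun v => f (a :: v)) g w

theorem wordConv_add (f f' g : List α → ℝ) (w : List α) :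
    wordConv (fun v => f v + f' v) g w = wordConv f g w + wordConv f' g w := by
  induction w generalizing f f' with
  | nil => simp only [wordConv]; ring
  | cons a w ih => simp only [wordConv, ih]; ring

theorem wordConv_mul_const (c : ℝ) (f g : List α → ℝ) (w : List α) :
    wordConv (fun v => f v * c) g w = wordConv f g w * c := by
  induction w generalizing f with
  | nil => simp only [wordConv]; ring
  | cons a w ih => simp only [wordConv, ih]; ring

theorem wordConv_eq_sum (f g : List α → ℝ) (w : List α) :
    wordConv f g w = ∑ p ∈ Finset.HasAntidiagonal.antidiagonal w.length,
      f (w.take p.1) * g (w.drop p.1) := by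
  induction w generalizing f with
  | nil => simp [wordConv]
  | cons a w ih =>
    rw [List.length_cons, Finset.Nat.antidiagonal_succ, Finset.sum_cons, Finset.sum_map, wordConv,
      ih]
    rfl

/-- Functions on words that are multiplicative for the shuffle product. -/
structure IsShuffleCharacter (f : List α → ℝ) : Prop where
  nil : f [] = 1
  shuffle : ∀ u w, shuffleSum f u w = f u * f w

/-- Deconcatenation is a morphism for the shuffle product, here with the second tensor factor
already evaluated by the character `g`. The induction moves first letters into `f`, which therefore
stays general. -/
theorem shuffleSum_wordConv (f : List α → ℝ) {g : List α → ℝ} (hg : IsShuffleCharacter g)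
    (u w : List α) : shuffleSum (wordConv f g) u w =
      wordConv (fun u' => wordConv (fun w' => shuffleSum f u' w') g w) g u := by
  induction u, w using wordShuffles.induct generalizing f with
  | case1 w => simp [wordConv, shuffleSum_nil_left, hg.nil]
  | case2 a u =>
    rw [shuffleSum_nil_right]
    simp only [wordConv, shuffleSum_nil_right, hg.nil, mul_one]
  | case3 a u b w ih1 ih2 =>
    -- This accounts for the cut before the first letter, where `f` sees only the empty word.
    have hgab := hg.shuffle (a :: u) (b :: w)
    rw [shuffleSum_cons_cons] at hgab ⊢
    have e : ∀ c : α, (fun v => wordConv f g (c :: v)) =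
        fun v => f [] * g (c :: v) + wordConv (fun v => f (c :: v)) g v := fun c => rfl
    rw [e, e, shuffleSum_add, shuffleSum_add, shuffleSum_const_mul, shuffleSum_const_mul, ih1, ih2]
    have e1 : ∀ u', wordConv (fun w' => shuffleSum f (a :: u') w') g (b :: w) =
        wordConv (fun w' => shuffleSum (fun v => f (a :: v)) u' w') g (b :: w) +
          wordConv (fun w' => shuffleSum (fun v => f (b :: v)) (a :: u') w') g w := by
      intro u'
      simp only [wordConv, shuffleSum_nil_right, shuffleSum_cons_cons, wordConv_add]
      ring
    have e2 : ∀ K : List α → ℝ, wordConv K g (a :: u) =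
        K [] * g (a :: u) + wordConv (fun v => K (a :: v)) g u := fun K => rfl
    rw [e2 fun u' => wordConv (fun w' => shuffleSum f u' w') g (b :: w)]
    rw [e2 fun u' => wordConv (fun w' => shuffleSum (fun v => f (b :: v)) u' w') g w]
    simp only [e1, wordConv_add, shuffleSum_nil_left]
    have e3 : wordConv (fun w' => f w') g (b :: w) =
      f [] * g (b :: w) + wordConv (fun v => f (b :: v)) g w := rfl
    rw [e3]
    linear_combination f [] * hgab

theorem IsShuffleCharacter.wordConv {f g : List α → ℝ} (hf : IsShuffleCharacter f)
    (hg : IsShuffleCharacter g) : IsShuffleCharacter (wordConv f g) := by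
  refine ⟨by simp [_root_.wordConv, hf.nil, hg.nil], fun u w => ?_⟩
  rw [shuffleSum_wordConv f hg]
  have : ∀ u', _root_.wordConv (fun w' => shuffleSum f u' w') g w =
      f u' * _root_.wordConv f g w := fun u' => by
    simp only [hf.shuffle, mul_comm (f u'), wordConv_mul_const]
  simp only [this, wordConv_mul_const]

/-- All shuffles have the same letters and length, and their number obeys Pascal's rule. A general
`g` is needed because removing a letter shifts the length. -/
theorem shuffleSum_prod (x : α → ℝ) (g : ℕ → ℝ) (u w : List α) :
    shuffleSum (fun v => (v.map x).prod * g v.length) u w =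
      (u.map x).prod * (w.map x).prod * ((u.length + w.length).choose u.length *
        g (u.length + w.length)) := by
  induction u, w using wordShuffles.induct generalizing g with
  | case1 w => simp [shuffleSum_nil_left]
  | case2 a u => simp [shuffleSum_nil_right]
  | case3 a u b w ih1 ih2 =>
    rw [shuffleSum_cons_cons]
    simp only [List.map_cons, List.prod_cons, List.length_cons, mul_assoc, shuffleSum_const_mul]
    rw [ih1 fun n => g (n + 1), ih2 fun n => g (n + 1)]
    simp only [List.map_cons, List.prod_cons, List.length_cons]
    have h1 : u.length + 1 + (w.length + 1) = (u.length + w.length + 1) + 1 := by ring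
    have h2 : u.length + (w.length + 1) + 1 = (u.length + w.length + 1) + 1 := by ring
    have h3 : u.length + 1 + w.length + 1 = (u.length + w.length + 1) + 1 := by ring
    have h4 : u.length + (w.length + 1) = u.length + w.length + 1 := by ring
    have h5 : u.length + 1 + w.length = u.length + w.length + 1 := by ring
    rw [h1, h2, h3, h4, h5, Nat.choose_succ_succ (u.length + w.length + 1) u.length]
    push_cast
    ring

theorem isShuffleCharacter_exp (x : α → ℝ) :
    IsShuffleCharacter fun v : List α => (v.map x).prod * ((v.length)! : ℝ)⁻¹ := by
  refine ⟨by simp, fun u w => ?_⟩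
  rw [shuffleSum_prod x (fun n => (n ! : ℝ)⁻¹), Nat.cast_add_choose]
  field_simp

/-- Shuffling adds lengths, so dilations preserve characters. Hence a tensor normalization does not
destroy the shuffle identity. -/
theorem IsShuffleCharacter.scale {f : List α → ℝ} (hf : IsShuffleCharacter f) (c : ℝ) :
    IsShuffleCharacter fun v => c ^ v.length * f v := by
  refine ⟨by simp [hf.nil], fun u w => ?_⟩
  have : shuffleSum (fun v => c ^ v.length * f v) u w =
      shuffleSum (fun v => c ^ (u.length + w.length) * f v) u w := by
    refine congrArg List.sum (List.map_congr_left fun v hv => ?_)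
    rw [length_of_mem_wordShuffles hv]
  rw [this, shuffleSum_const_mul, hf.shuffle, pow_add]
  ring

/-- A cut of `a ⋯ a l` falls either before `l` or at the very end. -/
theorem wordConv_replicate_append (f g : List α → ℝ) (a l : α) (n : ℕ) :
    wordConv f g (List.replicate n a ++ [l]) =
      ∑ i ∈ Finset.range (n + 1), f (List.replicate i a) * g (List.replicate (n - i) a ++ [l]) +
        f (List.replicate n a ++ [l]) * g [] := by
  induction n generalizing f with
  | zero => simp [wordConv]
  | succ n ih =>
    rw [List.replicate_succ, List.cons_append, wordConv, ih, Finset.sum_range_succ' _ (n + 1)]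
    simp only [List.replicate_succ, List.cons_append, Nat.add_sub_add_right, List.replicate_zero,
      Nat.sub_zero]
    ring

end Shuffle

/-! ### Coordinates of tensor series along words of functionals. -/

section Pairing

variable {E : Type u} [NormedAddCommGroup E] [NormedSpace ℝ E]

/-- The elementary functional `l₀ ⊗ ⋯ ⊗ l_{m-1}` on the `m`-th tensor power. -/
def elementaryFunctional (l : ℕ → (E →L[ℝ] ℝ)) (m : ℕ) : ⨂[ℝ]^m E →ₗ[ℝ] ℝ :=
  PiTensorProduct.lift ((MultilinearMap.mkPiAlgebra ℝ (Fin m) ℝ).compLinearMap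
    fun i => (l i : E →ₗ[ℝ] ℝ))

theorem elementaryFunctional_tprod (l : ℕ → (E →L[ℝ] ℝ)) (m : ℕ) (v : Fin m → E) :
    elementaryFunctional l m (PiTensorProduct.tprod ℝ v) = ∏ i : Fin m, l i (v i) := by
  simp [elementaryFunctional]

theorem elementaryFunctional_congr {l l' : ℕ → (E →L[ℝ] ℝ)} {m : ℕ}
    (h : ∀ i < m, l i = l' i) : elementaryFunctional l m = elementaryFunctional l' m := by
  unfold elementaryFunctional
  congr 2
  ext i : 1
  rw [h i i.2]

/-- Indexing the functionals by `ℕ` makes the split a plain shift, free of casts between `Fin`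
types. -/
theorem elementaryFunctional_mul (l : ℕ → (E →L[ℝ] ℝ)) (i j : ℕ) (a : ⨂[ℝ]^i E) (b : ⨂[ℝ]^j E) :
    elementaryFunctional l (i + j) (TensorPower.mulEquiv (a ⊗ₜ[ℝ] b)) =
      elementaryFunctional l i a * elementaryFunctional (fun k => l (i + k)) j b := by
  induction a using PiTensorProduct.induction_on with
  | smul_tprod r v =>
    induction b using PiTensorProduct.induction_on with
    | smul_tprod s v' =>
      rw [TensorProduct.smul_tmul_smul, map_smul, map_smul, map_smul, map_smul,
        ← TensorPower.gMul_def, TensorPower.tprod_mul_tprod, elementaryFunctional_tprod,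
        elementaryFunctional_tprod, elementaryFunctional_tprod, Fin.prod_univ_add]
      simp only [Fin.append_left, Fin.append_right, Fin.val_castAdd, Fin.val_natAdd, smul_eq_mul]
      ring
    | add b b' hb hb' => rw [TensorProduct.tmul_add, map_add, map_add, map_add, hb, hb', mul_add]
  | add a a' ha ha' => rw [TensorProduct.add_tmul, map_add, map_add, map_add, ha, ha', add_mul]

theorem elementaryFunctional_cast (l : ℕ → (E →L[ℝ] ℝ)) {m n : ℕ} (h : m = n) (a : ⨂[ℝ]^m E) :
    elementaryFunctional l n (TensorPower.cast ℝ E h a) = elementaryFunctional l m a := by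
  subst h
  rw [TensorPower.cast_refl]
  rfl

/-- The coordinate of a tensor series along a word of functionals. -/
def wordPairing (s : (m : ℕ) → ⨂[ℝ]^m E) (w : List (E →L[ℝ] ℝ)) : ℝ :=
  elementaryFunctional (fun i => w.getD i 0) w.length (s w.length)

theorem wordPairing_tensorExp (v : E) (w : List (E →L[ℝ] ℝ)) :
    wordPairing (tensorExp v) w = (w.map fun l => l v).prod * ((w.length)! : ℝ)⁻¹ := by
  rw [wordPairing, tensorExp, map_smul, elementaryFunctional_tprod, smul_eq_mul, mul_comm]
  congr 1
  rw [← List.prod_ofFn]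
  congr 1
  refine List.ext_getElem (by simp) fun i h1 h2 => ?_
  simp

theorem wordPairing_tensorOne :
    wordPairing (tensorOne : (m : ℕ) → ⨂[ℝ]^m E) = wordPairing (tensorExp (0 : E)) := by
  have : (tensorOne : (m : ℕ) → ⨂[ℝ]^m E) = tensorExp 0 := by
    funext m
    cases m with
    | zero => exact (tensorExp_zero 0).symm
    | succ m =>
      rw [tensorExp, MultilinearMap.map_coord_zero _ 0 rfl, smul_zero]
      rfl
  rw [this]

theorem wordPairing_tensorConv (s t : (m : ℕ) → ⨂[ℝ]^m E) :
    wordPairing (tensorConv s t) = wordConv (wordPairing s) (wordPairing t) := by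
  funext w
  rw [wordConv_eq_sum, wordPairing, tensorConv, map_sum,
    ← Finset.sum_coe_sort (Finset.HasAntidiagonal.antidiagonal w.length)]
  refine Finset.sum_congr rfl ?_
  rintro ⟨⟨i, j⟩, hp⟩ -
  have hij : i + j = w.length := Finset.HasAntidiagonal.mem_antidiagonal.mp hp
  rw [elementaryFunctional_cast, elementaryFunctional_mul]
  have hi : (w.take i).length = i := by simp; omega
  have hj : (w.drop i).length = j := by simp; omega
  simp only [wordPairing]
  congr 1
  · rw [hi]
    refine LinearMap.congr_fun (elementaryFunctional_congr fun k hk => ?_) _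
    simp [List.getD_eq_getElem?_getD, hk]
  · rw [hj]
    refine LinearMap.congr_fun (elementaryFunctional_congr fun k hk => ?_) _
    simp [List.getD_eq_getElem?_getD, List.getElem?_drop]

theorem isShuffleCharacter_tensorExp (v : E) : IsShuffleCharacter (wordPairing (tensorExp v)) := by
  simpa only [← wordPairing_tensorExp] using isShuffleCharacter_exp fun l : E →L[ℝ] ℝ => l v

theorem isShuffleCharacter_foldr {l : List ((m : ℕ) → ⨂[ℝ]^m E)}
    (h : ∀ s ∈ l, IsShuffleCharacter (wordPairing s)) :
    IsShuffleCharacter (wordPairing (l.foldr tensorConv tensorOne)) := by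
  induction l with
  | nil =>
    rw [List.foldr_nil, wordPairing_tensorOne]
    exact isShuffleCharacter_tensorExp 0
  | cons s l ih =>
    rw [List.foldr_cons, wordPairing_tensorConv]
    exact (h s (by simp)).wordConv (ih fun s' hs' => h s' (by simp [hs']))

theorem isShuffleCharacter_expProduct {n : ℕ} (v : Fin n → E) :
    IsShuffleCharacter
      (wordPairing ((List.ofFn fun t => tensorExp (v t)).foldr tensorConv tensorOne)) := by
  refine isShuffleCharacter_foldr fun s hs => ?_
  obtain ⟨t, rfl⟩ := List.mem_ofFn.mp hs
  exact isShuffleCharacter_tensorExp _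

/-- Binomial expansion with cancelling constant terms. It expresses how a leading exponential delays
all later time intervals by one unit. -/
theorem sub_pow_succ_div_factorial_eq_sum (n : ℕ) (x y : ℝ) :
    ((x + 1) ^ (n + 1) - (y + 1) ^ (n + 1)) / ((n + 1)! : ℝ) =
      ∑ i ∈ Finset.range (n + 1),
        (i ! : ℝ)⁻¹ * ((x ^ (n - i + 1) - y ^ (n - i + 1)) / ((n - i + 1)! : ℝ)) := by
  rw [add_pow, add_pow, ← Finset.sum_sub_distrib, Finset.sum_range_succ', ← Finset.sum_flip]
  simp only [one_pow, mul_one, pow_zero, sub_self, add_zero, Finset.sum_div]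
  refine Finset.sum_congr rfl fun i hi => ?_
  have hi : i ≤ n := Nat.lt_succ_iff.1 (Finset.mem_range.1 hi)
  rw [Nat.cast_choose ℝ (show n - i + 1 ≤ n + 1 by omega),
    show n + 1 - (n - i + 1) = i by omega]
  have h1 := Nat.factorial_ne_zero (n + 1)
  have h2 := Nat.factorial_ne_zero i
  have h3 := Nat.factorial_ne_zero (n - i + 1)
  field_simp

/-- The coordinates of a product of exponentials along the words `τ ⋯ τ l`, where `τ` has the value
`1` at all the exponents. -/
theorem wordPairing_expProduct (τ l : E →L[ℝ] ℝ) {n : ℕ} (v : Fin n → E) (hτ : ∀ t, τ (v t) = 1)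
    (k : ℕ) :
    wordPairing ((List.ofFn fun t => tensorExp (v t)).foldr tensorConv tensorOne)
        (List.replicate k τ ++ [l]) =
      ∑ t : Fin n, l (v t) * ((((t : ℕ) + 1 : ℝ) ^ (k + 1) - (t : ℕ) ^ (k + 1)) /
        ((k + 1)! : ℝ)) := by
  induction n generalizing k with
  | zero => simp [wordPairing_tensorOne, wordPairing_tensorExp]
  | succ n ih =>
    -- Split off the first exponential: if it takes the whole word it gives the term `t = 0`; if it
    -- takes `i` letters `τ`, it contributes `1 / i!` and the induction hypothesis applies to the
    -- rest.
    rw [List.ofFn_succ, List.foldr_cons, wordPairing_tensorConv, wordConv_replicate_append,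
      Fin.sum_univ_succ, (isShuffleCharacter_expProduct fun t : Fin n => v t.succ).nil, add_comm]
    congr 1
    · simp [wordPairing_tensorExp, hτ, div_eq_mul_inv]
    · simp only [ih (fun t => v t.succ) (fun t => hτ _), wordPairing_tensorExp, List.map_replicate,
        hτ, List.prod_replicate, one_pow, one_mul, List.length_replicate, Finset.mul_sum]
      rw [Finset.sum_comm]
      refine Finset.sum_congr rfl fun t _ => ?_
      rw [Fin.val_succ]
      push_cast
      rw [sub_pow_succ_div_factorial_eq_sum, Finset.mul_sum]
      exact Finset.sum_congr rfl fun i _ => by ring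

end Pairing

/-! ### Extension of word coordinates to the completed tensor algebra. -/

section WordFunctional

variable {E : Type u} [NormedAddCommGroup E] [NormedSpace ℝ E]

theorem exists_wordFunctional (N : AdmissibleNorms E) (w : List (E →L[ℝ] ℝ)) :
    ∃ L : TensorSeries N →L[ℝ] ℝ, ∀ (t : TensorSeries N) (a : ⨂[ℝ]^w.length E),
      t w.length = TensorPow.incl N w.length a →
        L t = elementaryFunctional (fun i => w.getD i 0) w.length a := by
  obtain ⟨C, hC⟩ := N.continuous_elementary w.length fun i => w.getD i 0
  let f : TensorPow N w.length →ₗ[ℝ] ℝ := elementaryFunctional (fun i => w.getD i 0) w.length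
  let g : TensorPow N w.length →L[ℝ] ℝ := f.mkContinuous C hC
  let e : TensorPow N w.length →L[ℝ] UniformSpace.Completion (TensorPow N w.length) :=
    UniformSpace.Completion.toComplL
  refine ⟨(g.extend e).comp (lp.evalCLM ℝ _ 1 w.length), fun t a h => ?_⟩
  have h1 : (g.extend e).comp (lp.evalCLM ℝ _ 1 w.length) t = g.extend e (t w.length) := rfl
  rw [h1, h]
  exact g.extend_eq UniformSpace.Completion.denseRange_coe
    (UniformSpace.Completion.isUniformInducing_coe _) a

/-- The continuous extension to all tensor series of the coordinate along a word of functionals. -/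
def wordFunctional (N : AdmissibleNorms E) (w : List (E →L[ℝ] ℝ)) : TensorSeries N →L[ℝ] ℝ :=
  (exists_wordFunctional N w).choose

end WordFunctional

/-! ### Recovering a path from its robust signature. -/

section RobustSignatureAlgebra

open scoped BoundedContinuousFunction

variable {T : ℕ} {W : Type u} [NormedAddCommGroup W] [NormedSpace ℝ W]

theorem wordFunctional_robustSignature (c : SignatureScheme W) (x : DPath T W)
    (w : List (TimeExt W →L[ℝ] ℝ)) :
    wordFunctional c.norms w (robustSignature c x) =
      c.normalization.scale (signature c.norms x) ^ w.length *
        wordPairing (sigComponents x) w := by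
  rw [wordPairing, ← smul_eq_mul, ← map_smul]
  refine (exists_wordFunctional c.norms w).choose_spec _ _ ?_
  rw [robustSignature, c.normalization.toFun_apply]
  exact (UniformSpace.Completion.coe_smul (X := TensorPow c.norms w.length) _ _).symm

theorem isShuffleCharacter_robustSignature (c : SignatureScheme W) (x : DPath T W) :
    IsShuffleCharacter fun w => wordFunctional c.norms w (robustSignature c x) := by
  simp only [wordFunctional_robustSignature]
  exact (isShuffleCharacter_expProduct _).scale _

theorem exists_polynomial_eval_eq_indicator (n k : ℕ) :
    ∃ p : Polynomial ℝ, ∀ i ≤ n, p.eval (i : ℝ) = if k < i then 1 else 0 := by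
  refine ⟨Lagrange.interpolate (Finset.range (n + 1)) (fun i : ℕ => (i : ℝ))
    fun i => if k < i then 1 else 0, fun i hi => ?_⟩
  exact Lagrange.eval_interpolate_at_node (r := fun i : ℕ => if k < i then (1 : ℝ) else 0)
    (s := Finset.range (n + 1)) (v := fun i : ℕ => (i : ℝ)) (Nat.cast_injective.injOn)
    (Finset.mem_range.2 (Nat.lt_succ_of_le hi))

/-- Choose a polynomial `p` interpolating the step function at `t₀`. Its differences `p(t + 1) -
p(t)` select the index `t₀`, and expanding `p` in monomials gives a fixed linear combination of the
given sums. -/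
theorem measurable_of_measurable_powerSums {Q : Type*} [MeasurableSpace Q] {n : ℕ}
    {v : Q → Fin n → ℝ}
    (h : ∀ k : ℕ, Measurable fun q => ∑ t : Fin n,
      v q t * ((((t : ℕ) + 1 : ℝ) ^ (k + 1) - (t : ℕ) ^ (k + 1)) / ((k + 1)! : ℝ)))
    (t₀ : Fin n) : Measurable fun q => v q t₀ := by
  obtain ⟨p, hp⟩ := exists_polynomial_eval_eq_indicator n t₀
  have e1 : ∀ q, v q t₀ =
      ∑ t : Fin n, v q t * (p.eval (((t : ℕ) + 1 : ℕ) : ℝ) - p.eval ((t : ℕ) : ℝ)) := by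
    intro q
    rw [Finset.sum_eq_single t₀]
    · rw [hp _ t₀.2, hp _ t₀.2.le]
      simp
    · intro t _ ht
      have ht : (t : ℕ) ≠ t₀ := fun h => ht (Fin.ext h)
      rw [hp _ t.2, hp _ t.2.le]
      rcases lt_or_gt_of_ne ht with h | h
      · rw [if_neg (by omega), if_neg (by omega), sub_self, mul_zero]
      · rw [if_pos (by omega), if_pos (by omega), sub_self, mul_zero]
    · simp
  have e2 : ∀ q, v q t₀ = ∑ k ∈ Finset.range (p.natDegree + 1), p.coeff k *
      ∑ t : Fin n, v q t * (((t : ℕ) + 1 : ℝ) ^ k - (t : ℕ) ^ k) := by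
    intro q
    rw [e1]
    simp only [Polynomial.eval_eq_sum_range, ← Finset.sum_sub_distrib, Finset.mul_sum]
    rw [Finset.sum_comm]
    refine Finset.sum_congr rfl fun k _ => Finset.sum_congr rfl fun t _ => ?_
    push_cast
    ring
  simp only [e2]
  refine Finset.measurable_fun_sum _ fun k _ => Measurable.const_mul ?_ _
  -- The constant coefficient has zero difference, so only powers `k + 1` are needed.
  cases k with
  | zero => simp
  | succ k =>
    have h1 := (h k).mul_const ((k + 1)! : ℝ)
    have h2 : ((k + 1)! : ℝ) ≠ 0 := Nat.cast_ne_zero.2 (Nat.factorial_ne_zero _)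
    simpa only [Finset.sum_mul, mul_assoc, div_mul_cancel₀ _ h2] using h1

/-- The time coordinate on `ℝ ⊕ W`. -/
def timeFunctional (W : Type u) [NormedAddCommGroup W] [NormedSpace ℝ W] : TimeExt W →L[ℝ] ℝ :=
  WithLp.fstL 1 ℝ ℝ W

/-- A path is a measurable function of the coordinates of its robust signature. -/
theorem measurable_functional_of_robustSignature (c : SignatureScheme W) {Q : Type*}
    [MeasurableSpace Q] {y : Q → DPath T W}
    (h : ∀ w, Measurable fun q => wordFunctional c.norms w (robustSignature c (y q)))
    (l : W →L[ℝ] ℝ) (t : Fin (T + 1)) : Measurable fun q => l (y q t) := by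
  simp only [wordFunctional_robustSignature] at h
  have formula : ∀ (l' : TimeExt W →L[ℝ] ℝ) (k : ℕ) (q : Q), wordPairing (sigComponents (y q))
      (List.replicate k (timeFunctional W) ++ [l']) = ∑ t : Fin (T + 1), l' (increment (y q) t) *
        ((((t : ℕ) + 1 : ℝ) ^ (k + 1) - (t : ℕ) ^ (k + 1)) / ((k + 1)! : ℝ)) := fun l' k q =>
    wordPairing_expProduct (timeFunctional W) l' (increment (y q)) (fun _ => rfl) k
  have hscale : Measurable fun q => c.normalization.scale (signature c.norms (y q)) := by
    -- The time increments sum to `T + 1`, so the coordinate of the one-letter word is `λ (T + 1)`.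
    -- Once `λ > 0` is known, it can be divided out of all coordinates.
    have h1 := (h [timeFunctional W]).div_const (T + 1 : ℝ)
    have h2 : ∀ q, wordPairing (sigComponents (y q)) [timeFunctional W] = T + 1 := fun q => by
      have h3 : ∀ t, timeFunctional W (increment (y q) t) = 1 := fun _ => rfl
      have := formula (timeFunctional W) 0 q
      simpa [h3] using this
    have h4 : (T + 1 : ℝ) ≠ 0 := by positivity
    simpa [h2, h4] using h1
  have hpair : ∀ w, Measurable fun q => wordPairing (sigComponents (y q)) w := fun w => by
    have h1 := (h w).div (hscale.pow_const w.length)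
    have h2 : ∀ q, c.normalization.scale (signature c.norms (y q)) ^ w.length ≠ 0 := fun q =>
      pow_ne_zero _ (c.normalization.scale_pos _).ne'
    have h3 : ∀ a b : ℝ, b ≠ 0 → b * a / b = a := fun a b hb => mul_div_cancel_left₀ a hb
    simpa only [Pi.div_def, h3 _ _ (h2 _)] using h1
  have hinc : ∀ t, Measurable fun q => (l.comp (WithLp.sndL 1 ℝ ℝ W)) (increment (y q) t) :=
    fun t => measurable_of_measurable_powerSums
      (v := fun q t => (l.comp (WithLp.sndL 1 ℝ ℝ W)) (increment (y q) t))
      (fun k => by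
        have := hpair (List.replicate k (timeFunctional W) ++ [l.comp (WithLp.sndL 1 ℝ ℝ W)])
        simpa only [formula] using this) t
  -- The increment at time `0` is `x(0)` itself, so partial sums of increments give the values of
  -- the path.
  induction t using Fin.induction with
  | zero => exact hinc 0
  | succ s ih =>
    have h1 := (hinc s.succ).add ih
    have h2 : ∀ q, (l.comp (WithLp.sndL 1 ℝ ℝ W)) (increment (y q) s.succ) =
        l (y q s.succ - y q s.castSucc) := fun _ => rfl
    simpa only [Pi.add_def, h2, map_sub, sub_add_cancel] using h1

end RobustSignatureAlgebra

/-! ### One rank step: from state space to measures on paths. -/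

section ExpectedRobustSignature

open scoped BoundedContinuousFunction

instance DPath.instSecondCountableTopology (T : ℕ) (Y : Type u) [TopologicalSpace Y]
    [SecondCountableTopology Y] : SecondCountableTopology (DPath T Y) :=
  inferInstanceAs (SecondCountableTopology (Fin (T + 1) → Y))

instance DPath.instMetrizableSpace (T : ℕ) (Y : Type u) [TopologicalSpace Y]
    [TopologicalSpace.MetrizableSpace Y] : TopologicalSpace.MetrizableSpace (DPath T Y) :=
  inferInstanceAs (TopologicalSpace.MetrizableSpace (Fin (T + 1) → Y))

variable {T : ℕ} {Y : Type u} [TopologicalSpace Y] {W : Type u} [NormedAddCommGroup W]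
  [NormedSpace ℝ W] (c : SignatureScheme W)

theorem borel_dPath_le [SecondCountableTopology Y] {M : MeasurableSpace (DPath T Y)}
    (h : ∀ t, @Measurable _ _ M (borel Y) fun x : DPath T Y => x t) : borel (DPath T Y) ≤ M := by
  let _ : MeasurableSpace Y := borel Y
  have : BorelSpace Y := ⟨rfl⟩
  have e : (MeasurableSpace.pi : MeasurableSpace (Fin (T + 1) → Y)) = borel (Fin (T + 1) → Y) :=
    BorelSpace.measurable_eq
  change borel (Fin (T + 1) → Y) ≤ M
  rw [← e]
  exact iSup_le fun t => (h t).comap_le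

theorem continuous_robustSignature_comp {S : Y → W} (hS : Continuous S) :
    Continuous fun x : DPath T Y => robustSignature c (fun t => S (x t) : DPath T W) :=
  (continuous_robustSignature c).comp
    (continuous_pi fun t => hS.comp (continuous_apply (A := fun _ : Fin (T + 1) => Y) t))

theorem exists_norm_robustSignature_le :
    ∃ R : ℝ, ∀ x : DPath T W, ‖robustSignature c x‖ ≤ R :=
  let ⟨R, hR⟩ := c.normalization.bounded_toFun
  ⟨R, fun _ => hR _⟩

/-- The coordinates of the robust signature as bounded continuous functions. -/
def robustCoordinate {S : Y → W} (hS : Continuous S) (w : List (TimeExt W →L[ℝ] ℝ)) :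
    DPath T Y →ᵇ ℝ :=
  BoundedContinuousFunction.ofNormedAddCommGroup
    (fun x => wordFunctional c.norms w (robustSignature c (fun t => S (x t) : DPath T W)))
    ((wordFunctional c.norms w).continuous.comp (continuous_robustSignature_comp c hS))
    (‖wordFunctional c.norms w‖ * (exists_norm_robustSignature_le (T := T) c).choose) fun _ =>
      (wordFunctional c.norms w).le_opNorm_of_le
        ((exists_norm_robustSignature_le c).choose_spec _)

/-- The shuffle identity turns products into sums, so the linear span of the coordinates is closed
under multiplication. -/
theorem robustCoordinate_mul {S : Y → W} (hS : Continuous S) (u w : List (TimeExt W →L[ℝ] ℝ)) :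
    (robustCoordinate c hS u * robustCoordinate c hS w : DPath T Y →ᵇ ℝ) =
      ((wordShuffles u w).map (robustCoordinate c hS)).sum := by
  ext x
  have h := (isShuffleCharacter_robustSignature c (fun t => S (x t) : DPath T W)).shuffle u w
  have e : ∀ L : List (List (TimeExt W →L[ℝ] ℝ)),
      (L.map (robustCoordinate c hS (T := T))).sum x =
        (L.map fun v => robustCoordinate c hS v x).sum := fun L => by
    induction L with
    | nil => rfl
    | cons v L ih =>
      simp only [List.map_cons, List.sum_cons, BoundedContinuousFunction.add_apply, ih]
  rw [e]
  exact h.symm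

/-- The algebra of functions spanned by the coordinates of the robust signature. -/
def robustAlgebra {S : Y → W} (hS : Continuous S) : Subalgebra ℝ (DPath T Y →ᵇ ℝ) :=
  (Submodule.span ℝ (Set.range (robustCoordinate c hS))).toSubalgebra
    (Submodule.subset_span ⟨[], by
      ext x
      exact (isShuffleCharacter_robustSignature c (fun t => S (x t) : DPath T W)).nil⟩)
    (fun f g hf hg => by
      induction hf using Submodule.span_induction with
      | mem f hf =>
        induction hg using Submodule.span_induction with
        | mem g hg =>
          obtain ⟨u, rfl⟩ := hf
          obtain ⟨w, rfl⟩ := hg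
          rw [robustCoordinate_mul]
          refine list_sum_mem fun k hk => ?_
          obtain ⟨v, -, rfl⟩ := List.mem_map.1 hk
          exact Submodule.subset_span ⟨v, rfl⟩
        | zero => rw [mul_zero]; exact Submodule.zero_mem _
        | add g g' _ _ hg hg' => rw [mul_add]; exact Submodule.add_mem _ hg hg'
        | smul a g _ hg => rw [mul_smul_comm]; exact Submodule.smul_mem _ a hg
      | zero => rw [zero_mul]; exact Submodule.zero_mem _
      | add g g' _ _ hg hg' => rw [add_mul]; exact Submodule.add_mem _ hg hg'
      | smul a g _ hg => rw [smul_mul_assoc]; exact Submodule.smul_mem _ a hg)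

theorem robustCoordinate_mem {S : Y → W} (hS : Continuous S) (w : List (TimeExt W →L[ℝ] ℝ)) :
    (robustCoordinate c hS w : DPath T Y →ᵇ ℝ) ∈ robustAlgebra c hS :=
  Submodule.subset_span (Set.mem_range_self w)

variable [SecondCountableTopology Y]

/-- The coordinates determine each `l (S (x t))` measurably; `hborel` upgrades this to each `x t`,
and second countability to the whole path. -/
theorem borel_dPath_le_iSup_robustAlgebra {S : Y → W} (hS : Continuous S)
    (hborel : borel Y ≤ ⨆ l : W →L[ℝ] ℝ, (borel ℝ).comap fun y => l (S y)) :
    borel (DPath T Y) ≤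
      ⨆ f : (robustAlgebra c hS : Subalgebra ℝ (DPath T Y →ᵇ ℝ)),
        (borel ℝ).comap (f : DPath T Y →ᵇ ℝ) := by
  set M : MeasurableSpace (DPath T Y) :=
    ⨆ f : (robustAlgebra c hS : Subalgebra ℝ (DPath T Y →ᵇ ℝ)),
      (borel ℝ).comap (f : DPath T Y →ᵇ ℝ) with hM
  have hcoord : ∀ w, Measurable[M] fun x : DPath T Y =>
      wordFunctional c.norms w (robustSignature c (fun t => S (x t) : DPath T W)) := fun w =>
    (comap_measurable (robustCoordinate c hS w)).mono
      (le_iSup (fun f : (robustAlgebra c hS : Subalgebra ℝ (DPath T Y →ᵇ ℝ)) =>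
        (borel ℝ).comap (f : DPath T Y →ᵇ ℝ)) ⟨_, robustCoordinate_mem c hS w⟩) le_rfl
  refine borel_dPath_le fun t => ?_
  rw [measurable_iff_comap_le]
  refine (MeasurableSpace.comap_mono hborel).trans ?_
  rw [MeasurableSpace.comap_iSup]
  refine iSup_le fun l => ?_
  rw [MeasurableSpace.comap_comp]
  exact (measurable_functional_of_robustSignature c hcoord l t).comap_le

theorem continuous_integral_robustSignature {S : Y → W} (hS : Continuous S) :
    Continuous fun μ : ProbabilityMeasure (DPath T Y) =>
      ∫ x : DPath T Y, robustSignature c (fun t => S (x t) : DPath T W) ∂(μ : Measure (DPath T Y)) :=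
  let ⟨_, hR⟩ := exists_norm_robustSignature_le (T := T) c
  continuous_integral_probabilityMeasure (continuous_robustSignature_comp c hS) fun _ => hR _

/-- A coordinate is a continuous functional of the robust signature and commutes with the Bochner
integral; linearity covers the span. -/
theorem measurable_integral_of_mem_robustAlgebra {S : Y → W} (hS : Continuous S)
    {M : MeasurableSpace (ProbabilityMeasure (DPath T Y))}
    (hM : ∀ L : TensorSeries c.norms →L[ℝ] ℝ, Measurable[M]
      fun μ : ProbabilityMeasure (DPath T Y) => L (∫ x : DPath T Y,
        robustSignature c (fun t => S (x t) : DPath T W) ∂(μ : Measure (DPath T Y))))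
    {f : DPath T Y →ᵇ ℝ} (hf : f ∈ robustAlgebra c hS) :
    Measurable[M] fun μ : ProbabilityMeasure (DPath T Y) =>
      ∫ x, f x ∂(μ : Measure (DPath T Y)) := by
  change f ∈ Submodule.span ℝ (Set.range (robustCoordinate c hS)) at hf
  induction hf using Submodule.span_induction with
  | mem f hf =>
    obtain ⟨w, rfl⟩ := hf
    obtain ⟨R, hR⟩ := exists_norm_robustSignature_le (T := T) c
    have e : ∀ μ : ProbabilityMeasure (DPath T Y),
        ∫ x, robustCoordinate c hS w x ∂(μ : Measure (DPath T Y)) =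
          wordFunctional c.norms w (∫ x : DPath T Y,
            robustSignature c (fun t => S (x t) : DPath T W) ∂(μ : Measure (DPath T Y))) :=
      fun μ => ContinuousLinearMap.integral_comp_comm _
        (integrable_of_continuous_of_norm_le (continuous_robustSignature_comp c hS)
          (fun _ => hR _) μ)
    simp only [e]
    exact hM _
  | zero => simp
  | add f g _ _ hf hg =>
    have e : ∀ μ : ProbabilityMeasure (DPath T Y),
        ∫ x, (f + g) x ∂(μ : Measure (DPath T Y)) = ∫ x, f x ∂(μ : Measure (DPath T Y)) +
          ∫ x, g x ∂(μ : Measure (DPath T Y)) :=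
      fun μ => integral_add (f.integrable _) (g.integrable _)
    simp only [e]
    exact hf.add hg
  | smul a f _ hf =>
    have e : ∀ μ : ProbabilityMeasure (DPath T Y),
        ∫ x, (a • f) x ∂(μ : Measure (DPath T Y)) = a * ∫ x, f x ∂(μ : Measure (DPath T Y)) :=
      fun μ => integral_const_mul _ _
    simp only [e]
    exact hf.const_mul a

theorem borel_probabilityMeasure_le_iSup_comap [TopologicalSpace.MetrizableSpace Y]
    {S : Y → W} (hS : Continuous S)
    (hborel : borel Y ≤ ⨆ l : W →L[ℝ] ℝ, (borel ℝ).comap fun y => l (S y)) :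
    borel (ProbabilityMeasure (DPath T Y)) ≤
      ⨆ L : TensorSeries c.norms →L[ℝ] ℝ, (borel ℝ).comap
        fun μ : ProbabilityMeasure (DPath T Y) => L (∫ x : DPath T Y,
          robustSignature c (fun t => S (x t) : DPath T W) ∂(μ : Measure (DPath T Y))) := by
  refine borel_probabilityMeasure_le _ fun B hB => ?_
  refine (Measure.measurable_coe hB).comp (measurable_toMeasure_of_subalgebra
    (borel_dPath_le_iSup_robustAlgebra c hS hborel) fun f hf =>
      measurable_integral_of_mem_robustAlgebra c hS (fun L => ?_) hf)
  exact (comap_measurable _).mono (le_iSup (fun L : TensorSeries c.norms →L[ℝ] ℝ =>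
    (borel ℝ).comap fun μ : ProbabilityMeasure (DPath T Y) => L (∫ x : DPath T Y,
      robustSignature c (fun t => S (x t) : DPath T W) ∂(μ : Measure (DPath T Y)))) L) le_rfl

end ExpectedRobustSignature

/-! ### Induction over ranks. -/

section HigherRankSignature

theorem rankProb_secondCountable_metrizable (T : ℕ) (V : Type u) [TopologicalSpace V]
    [SecondCountableTopology V] [TopologicalSpace.MetrizableSpace V] (k : ℕ) :
    SecondCountableTopology (rankProb T V k) ∧
      TopologicalSpace.MetrizableSpace (rankProb T V k) := by
  induction k with
  | zero =>
    exact ⟨inferInstanceAs (SecondCountableTopology V),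
      inferInstanceAs (TopologicalSpace.MetrizableSpace V)⟩
  | succ k ih =>
    have := ih.1
    have := ih.2
    exact ⟨secondCountableTopology_probabilityMeasure (X := DPath T (rankProb T V k)),
      instMetrizableSpaceProbabilityMeasure (DPath T (rankProb T V k))⟩

variable (c : ℕ → (W : BanachSp.{u}) → SignatureScheme W)
variable (T : ℕ) (V : Type u) [NormedAddCommGroup V] [NormedSpace ℝ V] [CompleteSpace V]
  [SecondCountableTopology V]

/-- The higher rank expected signature is continuous, and its composites with continuous
functionals generate the Borel σ-algebra. -/
theorem expectedSignature_continuous_and_borel_le (k : ℕ) :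
    Continuous (expectedSignature c T V k) ∧
      borel (rankProb T V k) ≤ ⨆ l : rankTensor c V k →L[ℝ] ℝ,
        (borel ℝ).comap fun y => l (expectedSignature c T V k y) := by
  induction k with
  | zero => exact ⟨continuous_id (X := V), borel_le_iSup_comap_dual (V := V)⟩
  | succ k ih =>
    have := (rankProb_secondCountable_metrizable T V k).1
    have := (rankProb_secondCountable_metrizable T V k).2
    exact ⟨continuous_integral_robustSignature (T := T) (c k (rankTensor c V k)) ih.1,
      borel_probabilityMeasure_le_iSup_comap (T := T) (c k (rankTensor c V k)) ih.1 ih.2⟩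

theorem continuous_expectedSignature (k : ℕ) : Continuous (expectedSignature c T V k) :=
  (expectedSignature_continuous_and_borel_le c T V k).1

/-- A σ-algebra generated by functions of `S̄_k` consists of unions of fibres of `S̄_k`. It contains
the closed set `{x}`, so that fibre is a singleton. -/
theorem injective_expectedSignature (k : ℕ) :
    Function.Injective (expectedSignature c T V k) := by
  intro x y hxy
  have := (rankProb_secondCountable_metrizable T V k).2
  have hx := (expectedSignature_continuous_and_borel_le c T V k).2 {x}
    (@MeasurableSpace.measurableSet_generateFrom _ _ _ isOpen_compl_singleton).of_compl
  have key : (⨆ l : rankTensor c V k →L[ℝ] ℝ,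
      (borel ℝ).comap fun y => l (expectedSignature c T V k y)) ≤
        (⊤ : MeasurableSpace (rankTensor c V k)).comap (expectedSignature c T V k) :=
    iSup_le fun l => by
      rintro _ ⟨B, -, rfl⟩
      exact ⟨l ⁻¹' B, trivial, rfl⟩
  obtain ⟨B, -, hB⟩ := key _ hx
  have h1 : x ∈ expectedSignature c T V k ⁻¹' B := hB ▸ Set.mem_singleton x
  have h2 : y ∈ expectedSignature c T V k ⁻¹' B := by
    rw [Set.mem_preimage, ← hxy]
    exact h1
  rw [hB] at h2
  exact (Set.mem_singleton_iff.1 h2).symm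

end HigherRankSignature

/-! ### Convergence of processes from continuity and injectivity. -/

theorem proposition4p6 {V : Type u} [NormedAddCommGroup V] [NormedSpace ℝ V] [CompleteSpace V]
    [SecondCountableTopology V] (T : ℕ)
    (c : ℕ → (W : BanachSp.{u}) → SignatureScheme W) (r : ℕ)
    (X : ℕ → AdaptedProcess.{u, w} T V) (Y : AdaptedProcess.{u, w} T V) :
    (Tendsto X atTop (@nhds _ (extendedWeakTopology T V r) Y) →
      Tendsto (fun n => adaptedSigDist c r (X n) Y) atTop (𝓝 0)) ∧
    ((∃ K : Set (AdaptedProcess.{u, w} T V),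
        @IsCompact _ (extendedWeakTopology T V r) K ∧ ∀ n, X n ∈ K) →
      Tendsto (fun n => adaptedSigDist c r (X n) Y) atTop (𝓝 0) →
      Tendsto X atTop (@nhds _ (extendedWeakTopology T V r) Y)) := by
  let law : AdaptedProcess.{u, w} T V → rankProb T V (r + 1) := fun A => A.predictionLaw r
  have hcont := continuous_expectedSignature c T V (r + 1)
  have hdist : ∀ n, adaptedSigDist c r (X n) Y =
      ‖expectedSignature c T V (r + 1) (law (X n)) - expectedSignature c T V (r + 1) (law Y)‖ :=
    fun _ => rfl
  have hnhds : Tendsto X atTop (@nhds _ (extendedWeakTopology T V r) Y) ↔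
      Tendsto (fun n => law (X n)) atTop (𝓝 (law Y)) := by
    rw [nhds_induced, tendsto_comap_iff]
    rfl
  simp only [hdist, ← tendsto_iff_norm_sub_tendsto_zero, hnhds]
  refine ⟨fun h => (hcont.tendsto _).comp h, fun ⟨K, hK, hXK⟩ h => ?_⟩
  have hlaw : @Continuous _ _ (extendedWeakTopology T V r) _ law := continuous_induced_dom
  -- Cluster points are studied among laws, since distinct processes may be indistinguishable in the
  -- extended weak topology.
  have hK' : IsCompact (law '' K) :=
    @IsCompact.image _ _ (extendedWeakTopology T V r) _ K law hK hlaw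
  refine hK'.tendsto_nhds_of_unique_mapClusterPt
    (Eventually.of_forall fun n => Set.mem_image_of_mem law (hXK n)) fun μ _ hμ => ?_
  apply injective_expectedSignature c T V (r + 1)
  -- The image of a cluster point is a cluster point of a norm convergent sequence, hence its limit.
  have hcl : MapClusterPt (expectedSignature c T V (r + 1) μ) atTop
      fun n => expectedSignature c T V (r + 1) (law (X n)) :=
    hμ.continuousAt_comp hcont.continuousAt
  exact eq_of_nhds_neBot (NeBot.mono hcl (inf_le_inf_left _ h))

end
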